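/- For integers $r\ge 2$, $q\ge 1$, $V\ge 1$ and $\lambda$, let $K_{r,q}(\lambda,V)$ be the number of integer tuples $(v_1,\dots,v_{2r})$ with $|v_1|,\dots,|v_{2r}|\le V$ and $\gcd(\lambda+v_i,q)=1$ for all $i$ such that $$\frac{1}{\lambda+v_1}+\dots+\frac{1}{\lambda+v_r}\equiv \frac{1}{\lambda+v_{r+1}}+\dots+\frac{1}{\lambda+v_{2r}} \pmod q,$$ where $1/a$ denotes the inverse of $a$ modulo $q$. Then for every fixed integer $r\ge 2$, $$K_{r,q}(\lambda,V)\ll\left(\frac{V^{2r}}{q^{1/(4(r-1))}}+V^{r}\right)q^{o(1)}$$ uniformly over all integers $q\ge1$, $V\ge1$ and $\lambda$; that is, for every $r\ge2$ and every $\varepsilon>0$ there is a constant $C=C(r,\varepsilon)>0$ such that for all integers $q\ge 1$, $V\ge 1$ and $\lambda$, $$K_{r,q}(\lambda,V)\le C\left(\frac{V^{2r}}{q^{1/(4(r-1))}}+V^{r}\right)q^{\varepsilon}.$$ -/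

import Mathlib

/-- `kloostermanCount r q lam V` is the number of integer tuples
`(v_1, …, v_r, w_1, …, w_r)` with all `|v_i|, |w_i| ≤ V` and all `lam + v_i`, `lam + w_i`
coprime to `q`, such that
`1/(lam + v_1) + ⋯ + 1/(lam + v_r) ≡ 1/(lam + w_1) + ⋯ + 1/(lam + w_r) (mod q)`.
Since every denominator is coprime to `q`, each inverse below is a genuine inverse in
`ZMod q` (for `1 ≤ q`). -/
noncomputable def kloostermanCount (r q : ℕ) (lam : ℤ) (V : ℕ) : ℕ :=
  (((Fintype.piFinset fun _ : Fin r => Finset.Icc (-(V : ℤ)) (V : ℤ)) ×ˢ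
      (Fintype.piFinset fun _ : Fin r => Finset.Icc (-(V : ℤ)) (V : ℤ))).filter
    fun p : (Fin r → ℤ) × (Fin r → ℤ) =>
      (∀ i, Int.gcd (lam + p.1 i) (q : ℤ) = 1) ∧
      (∀ i, Int.gcd (lam + p.2 i) (q : ℤ) = 1) ∧
      ∑ i, (((lam + p.1 i : ℤ) : ZMod q))⁻¹ = ∑ i, (((lam + p.2 i : ℤ) : ZMod q))⁻¹).card

/-!
Write `1/(lam + v₁) + ⋯ - 1/(lam + w_r) ≡ 0 (mod q)` over a common denominator: `-lam` is a root
modulo `q` of an integer polynomial (`recipNumerator`) of degree at most `2r - 2`, in which the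
coefficient of `X ^ (2r - 1 - k)` is `O(V ^ k)`.

*Short intervals.* If `V ^ (4r(r-1))` is small compared with `q`, the resultant of two such
polynomials is divisible by `q` and smaller than `q`, hence zero
(`exists_common_root_recipNumerator`). So all numerators are divisible by one of boundedly many
irreducible `f ∈ ℤ[X]`, namely factors of a single one of them. If `f` divides the numerator, then
`f (u i)` divides a bounded multiple of `lcm_{j ≠ i} (u i - u j) ^ deg f`
(`eval_dvd_mul_pow_of_dvd_recipNumerator`). This is a form of the remark that in a relation between
unit fractions the largest power of a prime dividing a denominator divides at least two of them.

The count then goes one entry at a time. Once the entries `t` before `v` are known, the numbers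
`gcd (f v, v - t)` divide `f t`, so they are known up to few choices and fix `v` modulo their least
common multiple `L`. If `v` is at distance about `X` from the roots of `f`, this leaves about
`1 + X / L` choices. Together the moduli `L` and `L'` belonging to an order of the entries and to
its reverse satisfy `X ≪ L * L'`, so `(1 + X / L) * (1 + X / L') ≪ V`: one of the two orders leaves
at most about `V ^ (m / 2)` choices for all `m` entries (`card_le_of_dvd_recipNumerator`). The
dyadic decomposition over `X` and `L` is replaced by the weights `rootWeight`. Coincident entries
either cancel, in groups of at least two, or combine to an injective solution with other
coefficients; so the count is `V ^ (r + o(1))` (`kloostermanCount_le_of_short`).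

*Long intervals.* An interval is cut into blocks of the longest length `V₀` for which the short
bound holds, so `V₀ ^ (4r(r-1))` is of order `q`. Expressing the count as a `2r`-th moment of
exponential sums, Hölder's inequality bounds it by `(4V / V₀) ^ (2r)` times the count for a block
(`kloostermanCount_mul_pow_le`), which is `V ^ (2r) / q ^ (1 / (4(r-1)))` up to `q ^ ε`.
-/

open Polynomial

/-! ### The divisor bound -/

lemma card_divisors_le_mul_rpow (ε : ℝ) (hε : 0 < ε) :
    ∃ C : ℝ, 1 ≤ C ∧ ∀ n : ℕ, (n.divisors.card : ℝ) ≤ C * (n : ℝ) ^ ε := by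
  obtain ⟨N, hN⟩ := exists_nat_gt ((2 : ℝ) ^ (1 / ε))
  set δ : ℝ := min 1 (ε * Real.log 2) with hδ
  have hlog : 0 < Real.log 2 := Real.log_pos (by norm_num)
  have hδ0 : 0 < δ := lt_min one_pos (mul_pos hε hlog)
  have hδ1 : δ ≤ 1 := min_le_left _ _
  have hK : 1 ≤ δ⁻¹ := (one_le_inv₀ hδ0).2 hδ1
  refine ⟨δ⁻¹ ^ N, one_le_pow₀ hK, fun n => ?_⟩
  rcases eq_or_ne n 0 with rfl | hn
  · simp [Real.zero_rpow hε.ne']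
  -- Only the finitely many primes `p` with `p ^ ε < 2` contribute a factor exceeding `1`.
  have key : ∀ p ∈ n.primeFactors, ((n.factorization p + 1 : ℕ) : ℝ) ≤
      (if p < N then δ⁻¹ else 1) * ((p : ℝ) ^ n.factorization p) ^ ε := by
    intro p hp
    have hp' := Nat.prime_of_mem_primeFactors hp
    set a := n.factorization p
    have hp2 : (2 : ℝ) ≤ p := by exact_mod_cast hp'.two_le
    have e1 : ((p : ℝ) ^ a) ^ ε = ((p : ℝ) ^ ε) ^ a := by
      rw [← Real.rpow_natCast, ← Real.rpow_natCast, ← Real.rpow_mul (by positivity),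
        ← Real.rpow_mul (by positivity), mul_comm]
    rw [e1]
    split_ifs with h
    · have h1 : 1 + ε * Real.log 2 ≤ (p : ℝ) ^ ε := by
        calc 1 + ε * Real.log 2 ≤ Real.exp (ε * Real.log 2) := by
              linarith [Real.add_one_le_exp (ε * Real.log 2)]
          _ = (2 : ℝ) ^ ε := by rw [Real.rpow_def_of_pos (by norm_num), mul_comm]
          _ ≤ _ := Real.rpow_le_rpow (by norm_num) hp2 hε.le
      have h2 : 1 + a * δ ≤ ((p : ℝ) ^ ε) ^ a := by
        calc 1 + a * δ ≤ (1 + δ) ^ a := one_add_mul_le_pow (by linarith) a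
          _ ≤ _ := by
            gcongr
            exact (add_le_add_right (min_le_right _ _) 1).trans h1
      rw [inv_mul_eq_div, le_div_iff₀ hδ0]
      push_cast
      nlinarith
    · have h1 : (2 : ℝ) ≤ (p : ℝ) ^ ε := by
        have : (2 : ℝ) ^ (1 / ε) ≤ p := hN.le.trans (by exact_mod_cast not_lt.1 h)
        calc (2 : ℝ) = ((2 : ℝ) ^ (1 / ε)) ^ ε := by
              rw [← Real.rpow_mul (by norm_num), one_div, inv_mul_cancel₀ hε.ne', Real.rpow_one]
          _ ≤ _ := Real.rpow_le_rpow (by positivity) this hε.le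
      rw [one_mul]
      calc ((a + 1 : ℕ) : ℝ) ≤ (2 : ℝ) ^ a := by exact_mod_cast Nat.lt_two_pow_self
        _ ≤ _ := by gcongr
  calc (n.divisors.card : ℝ) = ∏ p ∈ n.primeFactors, ((n.factorization p + 1 : ℕ) : ℝ) := by
        rw [Nat.card_divisors hn]; push_cast; rfl
    _ ≤ ∏ p ∈ n.primeFactors, (if p < N then δ⁻¹ else 1) * ((p : ℝ) ^ n.factorization p) ^ ε :=
        Finset.prod_le_prod (fun _ _ => by positivity) key
    _ = (∏ p ∈ n.primeFactors, (if p < N then δ⁻¹ else 1)) * (n : ℝ) ^ ε := by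
        rw [Finset.prod_mul_distrib, Real.finsetProd_rpow _ _ (fun _ _ => by positivity)]
        congr 2
        conv_rhs => rw [← Nat.prod_factorization_pow_eq_self hn]
        rw [Finsupp.prod]
        push_cast
        rfl
    _ ≤ _ := by
        gcongr
        rw [Finset.prod_ite, Finset.prod_const, Finset.prod_const_one, mul_one]
        refine pow_le_pow_right₀ hK ?_
        calc _ ≤ (Finset.range N).card :=
              Finset.card_le_card fun p hp => by simp at hp ⊢; exact hp.2
          _ = N := by simp

/-! ### Residue classes near a point, and real parts of roots -/

/-- The sum over the elements on one side of `ρ`, the side given by the sign `s`: the quotients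
`⌊|v - ρ| / L⌋` are distinct. -/
lemma sum_div_add_abs_le_of_le {L V : ℕ} (hL : 0 < L) {ρ : ℝ} (s : ℝ) (hs : s = 1 ∨ s = -1)
    (S : Finset ℤ) (hSL : ∀ v ∈ S, ∀ w ∈ S, (L : ℤ) ∣ v - w)
    (hSV : ∀ v ∈ S, |(v : ℝ) - ρ| ≤ 2 * V) (hS : ∀ v ∈ S, 0 ≤ s * (v - ρ)) :
    ∑ v ∈ S, (L : ℝ) / (L + |(v : ℝ) - ρ|) ≤
      ∑ t ∈ Finset.range (2 * V + 1), (1 : ℝ) / (t + 1) := by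
  have hL' : (0 : ℝ) < L := by exact_mod_cast hL
  have hL1 : (1 : ℝ) ≤ L := by exact_mod_cast hL
  have habs : ∀ v ∈ S, |(v : ℝ) - ρ| = s * (v - ρ) := fun v hv => by
    have := hS v hv
    rcases hs with rfl | rfl
    · rw [one_mul] at *; exact abs_of_nonneg this
    · rw [neg_one_mul] at *; exact abs_of_nonpos (by linarith)
  set g : ℤ → ℕ := fun v => ⌊|(v : ℝ) - ρ| / L⌋₊ with hg
  have hinj : Set.InjOn g S := by
    intro v hv w hw h
    have hv1 := Nat.floor_le (div_nonneg (abs_nonneg ((v : ℝ) - ρ)) hL'.le)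
    have hv2 := Nat.lt_floor_add_one (|(v : ℝ) - ρ| / L)
    have hw1 := Nat.floor_le (div_nonneg (abs_nonneg ((w : ℝ) - ρ)) hL'.le)
    have hw2 := Nat.lt_floor_add_one (|(w : ℝ) - ρ| / L)
    change ⌊|(v : ℝ) - ρ| / L⌋₊ = ⌊|(w : ℝ) - ρ| / L⌋₊ at h
    rw [h] at hv1 hv2
    rw [le_div_iff₀ hL'] at hv1 hw1
    rw [div_lt_iff₀ hL'] at hv2 hw2
    have hva := habs v hv
    have hwa := habs w hw
    have h3 : |((v - w : ℤ) : ℝ)| < L := by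
      push_cast
      rw [abs_lt]
      rcases hs with rfl | rfl <;> constructor <;> linarith
    have h4 : |v - w| < L := by exact_mod_cast h3
    have := Int.eq_zero_of_abs_lt_dvd (hSL v hv w hw) h4
    omega
  calc _ ≤ ∑ v ∈ S, (1 : ℝ) / (g v + 1) := by
        refine Finset.sum_le_sum fun v hv => ?_
        have hv1 := Nat.floor_le (div_nonneg (abs_nonneg ((v : ℝ) - ρ)) hL'.le)
        rw [le_div_iff₀ hL'] at hv1
        rw [div_le_div_iff₀ (by positivity) (by positivity)]
        nlinarith
    _ = ∑ t ∈ S.image g, (1 : ℝ) / (t + 1) := by rw [Finset.sum_image hinj]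
    _ ≤ _ := by
        refine Finset.sum_le_sum_of_subset_of_nonneg ?_ fun _ _ _ => by positivity
        intro t ht
        obtain ⟨v, hv, rfl⟩ := Finset.mem_image.1 ht
        rw [Finset.mem_range, Nat.lt_succ_iff]
        refine Nat.floor_le_of_le ?_
        push_cast
        exact (div_le_self (abs_nonneg _) hL1).trans (hSV v hv)

lemma sum_div_add_abs_le {L V : ℕ} (hL : 0 < L) {ρ : ℝ} (hρ : |ρ| ≤ V)
    (S : Finset ℤ) (hSL : ∀ v ∈ S, ∀ w ∈ S, (L : ℤ) ∣ v - w) (hSV : ∀ v ∈ S, |v| ≤ V) :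
    ∑ v ∈ S, (L : ℝ) / (L + |(v : ℝ) - ρ|) ≤
      2 * ∑ t ∈ Finset.range (2 * V + 1), (1 : ℝ) / (t + 1) := by
  classical
  have h1 : ∀ v ∈ S, |(v : ℝ) - ρ| ≤ 2 * V := fun v hv => by
    have : |(v : ℝ)| ≤ V := by exact_mod_cast hSV v hv
    have := abs_sub (v : ℝ) ρ
    linarith
  rw [← Finset.sum_filter_add_sum_filter_not S (fun v : ℤ => ρ ≤ v), two_mul]
  refine add_le_add (sum_div_add_abs_le_of_le hL 1 (.inl rfl) _ ?_ ?_ ?_)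
    (sum_div_add_abs_le_of_le hL (-1) (.inr rfl) _ ?_ ?_ ?_)
  all_goals intro v hv; rw [Finset.mem_filter] at hv
  · intro w hw; exact hSL v hv.1 w (Finset.mem_filter.1 hw).1
  · exact h1 v hv.1
  · linarith [hv.2]
  · intro w hw; exact hSL v hv.1 w (Finset.mem_filter.1 hw).1
  · exact h1 v hv.1
  · linarith [hv.2]

/-- The points `ρ k` are the real parts of the complex roots of `f`, moved to the nearest point of
`[-V, V]`. -/
lemma exists_real_prod_abs_sub_le_abs_eval {f : ℤ[X]} (hf : f ≠ 0) (V : ℕ) :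
    ∃ ρ : Fin f.natDegree → ℝ, (∀ k, |ρ k| ≤ V) ∧
      ∀ v : ℤ, |v| ≤ V → ∏ k, |(v : ℝ) - ρ k| ≤ |((f.eval v : ℤ) : ℝ)| := by
  set F := f.map (Int.castRingHom ℂ) with hF
  have hinj : Function.Injective (Int.castRingHom ℂ) := Int.cast_injective
  have hspl : F.Splits := IsAlgClosed.splits F
  have hcard : F.roots.toList.length = f.natDegree := by
    rw [Multiset.length_toList, ← hspl.natDegree_eq_card_roots, hF,
      natDegree_map_eq_of_injective hinj]
  refine ⟨fun k => max (-V) (min V (F.roots.toList.get (k.cast hcard.symm)).re), fun k => ?_,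
    fun v hv => ?_⟩
  · rw [abs_le]
    exact ⟨le_max_left _ _, max_le (by have : (0:ℝ) ≤ V := by positivity
                                       linarith) (min_le_left _ _)⟩
  have hv' : |(v : ℝ)| ≤ V := by exact_mod_cast hv
  rw [abs_le] at hv'
  have hev : ((f.eval v : ℤ) : ℂ) = F.leadingCoeff * (F.roots.map fun a => (v : ℂ) - a).prod := by
    have h1 : F.eval (v : ℂ) = ((f.eval v : ℤ) : ℂ) := by
      rw [hF, eval_intCast_map]; simp
    rw [← h1, hspl.eval_eq_prod_roots]
  have hlc : 1 ≤ ‖F.leadingCoeff‖ := by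
    rw [hF, leadingCoeff_map_of_injective hinj]
    simp only [eq_intCast, Complex.norm_intCast]
    exact_mod_cast Int.one_le_abs (leadingCoeff_ne_zero.2 hf)
  have hprod : (F.roots.map fun a => (v : ℂ) - a).prod =
      ∏ k : Fin f.natDegree, ((v : ℂ) - F.roots.toList.get (k.cast hcard.symm)) := by
    conv_lhs => rw [← Multiset.coe_toList F.roots]
    rw [Multiset.map_coe, Multiset.prod_coe, ← List.prod_ofFn]
    congr 1
    apply List.ext_get
    · simp [hcard]
    · intro n h1 h2; simp
  have hn : |((f.eval v : ℤ) : ℝ)| = ‖((f.eval v : ℤ) : ℂ)‖ := by rw [Complex.norm_intCast]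
  rw [hn, hev, hprod, norm_mul, norm_prod]
  calc _ ≤ ∏ k : Fin f.natDegree, ‖(v : ℂ) - F.roots.toList.get (k.cast hcard.symm)‖ := by
        refine Finset.prod_le_prod (fun _ _ => abs_nonneg _) fun k _ => ?_
        dsimp only
        set β := F.roots.toList.get (k.cast hcard.symm)
        have h1 := Complex.abs_re_le_norm ((v : ℂ) - β)
        simp only [Complex.sub_re, Complex.intCast_re] at h1
        refine le_trans ?_ h1
        rcases le_total β.re V with h | h
        · rw [min_eq_right h]
          rcases le_total (-V : ℝ) β.re with h' | h'
          · rw [max_eq_right h']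
          · rw [max_eq_left h', abs_of_nonneg (by linarith), abs_of_nonneg (by linarith)]; linarith
        · rw [min_eq_left h, max_eq_right (by linarith), abs_of_nonpos (by linarith),
            abs_of_nonpos (by linarith)]; linarith
    _ ≤ _ := le_mul_of_one_le_left (by positivity) hlc

/-! ### Distributivity of gcd over lcm -/

lemma gcd_lcm_dvd_lcm_gcd (M a b : ℕ) :
    Nat.gcd M (Nat.lcm a b) ∣ Nat.lcm (Nat.gcd M a) (Nat.gcd M b) := by
  rcases eq_or_ne a 0 with rfl | ha
  · simpa using Nat.dvd_lcm_left M (M.gcd b)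
  rcases eq_or_ne b 0 with rfl | hb
  · simpa using Nat.dvd_lcm_right (M.gcd a) M
  rw [Nat.dvd_iff_prime_pow_dvd_dvd]
  intro p k hp h
  have h1 : p ^ k ∣ M := h.trans (Nat.gcd_dvd_left _ _)
  have h2 : p ^ k ∣ a.lcm b := h.trans (Nat.gcd_dvd_right _ _)
  rw [hp.pow_dvd_iff_le_factorization (Nat.lcm_ne_zero ha hb), Nat.factorization_lcm ha hb,
    Finsupp.sup_apply, le_sup_iff, ← hp.pow_dvd_iff_le_factorization ha,
    ← hp.pow_dvd_iff_le_factorization hb] at h2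
  rcases h2 with h2 | h2
  · exact (Nat.dvd_gcd h1 h2).trans (Nat.dvd_lcm_left _ _)
  · exact (Nat.dvd_gcd h1 h2).trans (Nat.dvd_lcm_right _ _)

lemma gcd_finset_lcm_dvd {α : Type*} [DecidableEq α] (M : ℕ) (F : Finset α) (g : α → ℕ) :
    Nat.gcd M (F.lcm g) ∣ F.lcm fun t => Nat.gcd M (g t) := by
  induction F using Finset.induction_on with
  | empty => simp
  | insert a F ha ih =>
    rw [Finset.lcm_insert, Finset.lcm_insert]
    exact (gcd_lcm_dvd_lcm_gcd _ _ _).trans (lcm_dvd_lcm dvd_rfl ih)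

/-! ### The numerator of a sum of reciprocals -/

lemma abs_coeff_prod_X_sub_C_le {κ : Type*} [DecidableEq κ] {V : ℤ} (hV : 0 ≤ V) (u : κ → ℤ)
    (hu : ∀ i, |u i| ≤ V) (s : Finset κ) (t : ℕ) :
    |(∏ j ∈ s, (X - C (u j))).coeff t| * V ^ t ≤ (2 * V) ^ s.card := by
  induction s using Finset.induction_on generalizing t with
  | empty =>
    rw [Finset.prod_empty, coeff_one]
    split_ifs with h <;> simp [h]
  | insert a s ha ih =>
    rw [Finset.prod_insert ha, Finset.card_insert_of_notMem ha, sub_mul]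
    have h2 : |(C (u a) * ∏ j ∈ s, (X - C (u j))).coeff t| * V ^ t ≤ V * (2 * V) ^ s.card := by
      rw [coeff_C_mul, abs_mul, mul_assoc]
      exact mul_le_mul (hu a) (ih t) (by positivity) hV
    have h1 : |(X * ∏ j ∈ s, (X - C (u j))).coeff t| * V ^ t ≤ V * (2 * V) ^ s.card := by
      cases t with
      | zero => simp; positivity
      | succ t =>
        rw [coeff_X_mul, pow_succ', mul_left_comm]
        exact mul_le_mul_of_nonneg_left (ih t) hV
    rw [coeff_sub]
    have := mul_le_mul_of_nonneg_right
      (abs_sub ((X * ∏ j ∈ s, (X - C (u j))).coeff t)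
        ((C (u a) * ∏ j ∈ s, (X - C (u j))).coeff t))
      (pow_nonneg hV t)
    calc _ ≤ _ := this
      _ ≤ V * (2 * V) ^ s.card + V * (2 * V) ^ s.card := by rw [add_mul]; exact add_le_add h1 h2
      _ = _ := by ring

section Numerator

variable {ι : Type*} [Fintype ι] [DecidableEq ι]

/-- The numerator of the rational function `∑ k, c k / (X - u k)` over the common denominator
`∏ k, (X - u k)`. -/
noncomputable def recipNumerator (c u : ι → ℤ) : ℤ[X] :=
  ∑ k, C (c k) * ∏ j ∈ Finset.univ.erase k, (X - C (u j))

lemma eval_recipNumerator (c u : ι → ℤ) (i : ι) :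
    (recipNumerator c u).eval (u i) = c i * ∏ j ∈ Finset.univ.erase i, (u i - u j) := by
  rw [recipNumerator, eval_finsetSum, Finset.sum_eq_single i]
  · simp [eval_prod]
  · intro k _ hk
    rw [eval_mul, eval_prod, Finset.prod_eq_zero (i := i) (by simp [hk.symm]) (by simp), mul_zero]
  · simp

lemma eval_recipNumerator_ne_zero {c u : ι → ℤ} (hu : Function.Injective u) {i : ι}
    (hc : c i ≠ 0) : (recipNumerator c u).eval (u i) ≠ 0 := by
  rw [eval_recipNumerator]
  refine mul_ne_zero hc (Finset.prod_ne_zero_iff.2 fun j hj => sub_ne_zero.2 fun h => ?_)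
  exact (Finset.mem_erase.1 hj).1 (hu h).symm

lemma natDegree_prod_erase_X_sub_C (u : ι → ℤ) (k : ι) :
    (∏ j ∈ Finset.univ.erase k, (X - C (u j))).natDegree = Fintype.card ι - 1 := by
  rw [natDegree_prod_of_monic _ _ fun j _ => monic_X_sub_C _]
  simp only [natDegree_X_sub_C]
  simp [Finset.card_erase_of_mem]

/-- The coefficient of `X ^ (card ι - 1)` is `∑ k, c k`. -/
lemma natDegree_recipNumerator_lt {c u : ι → ℤ} (hc : ∑ k, c k = 0) (h2 : 2 ≤ Fintype.card ι) :
    (recipNumerator c u).natDegree < Fintype.card ι - 1 := by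
  have h : (recipNumerator c u).natDegree ≤ Fintype.card ι - 1 := by
    refine natDegree_sum_le_of_forall_le _ _ fun k _ => ?_
    exact (natDegree_C_mul_le _ _).trans (natDegree_prod_erase_X_sub_C u k).le
  refine lt_of_le_of_ne h fun heq => ?_
  have h0 : (recipNumerator c u).coeff (Fintype.card ι - 1) = 0 := by
    rw [recipNumerator, finsetSum_coeff, ← hc]
    refine Finset.sum_congr rfl fun k _ => ?_
    rw [coeff_C_mul, ← natDegree_prod_erase_X_sub_C u k, coeff_natDegree,
      (monic_prod_of_monic _ _ fun j _ => monic_X_sub_C _).leadingCoeff, mul_one]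
  rw [← heq, coeff_natDegree, leadingCoeff_eq_zero] at h0
  rw [h0, natDegree_zero] at heq
  omega

lemma abs_coeff_recipNumerator_le {V B : ℤ} (hV : 0 ≤ V) {c u : ι → ℤ} (hu : ∀ i, |u i| ≤ V)
    (hc : ∀ i, |c i| ≤ B) (t : ℕ) :
    |(recipNumerator c u).coeff t| * V ^ t ≤
      Fintype.card ι * (B * (2 * V) ^ (Fintype.card ι - 1)) := by
  rw [recipNumerator, finsetSum_coeff]
  calc _ ≤ (∑ k, |(C (c k) * ∏ j ∈ Finset.univ.erase k, (X - C (u j))).coeff t|) * V ^ t := by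
        gcongr; exact Finset.abs_sum_le_sum_abs _ _
    _ ≤ ∑ _k : ι, B * (2 * V) ^ (Fintype.card ι - 1) := by
        rw [Finset.sum_mul]
        refine Finset.sum_le_sum fun k _ => ?_
        rw [coeff_C_mul, abs_mul, mul_assoc]
        refine mul_le_mul (hc k) ?_ (by positivity) ((abs_nonneg _).trans (hc k))
        have := abs_coeff_prod_X_sub_C_le hV u hu (Finset.univ.erase k) t
        rwa [Finset.card_erase_of_mem (Finset.mem_univ k), Finset.card_univ] at this
    _ = _ := by simp

/-- Clearing denominators in a vanishing sum of reciprocals modulo `q`. -/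
lemma eval_recipNumerator_eq_zero {q : ℕ} (c u : ι → ℤ) (lam : ℤ)
    (hu : ∀ i, IsUnit ((lam + u i : ℤ) : ZMod q))
    (h : ∑ i, (c i : ZMod q) * ((lam + u i : ℤ) : ZMod q)⁻¹ = 0) :
    (((recipNumerator c u).eval (-lam) : ℤ) : ZMod q) = 0 := by
  have key : (((recipNumerator c u).eval (-lam) : ℤ) : ZMod q) * (-1) =
      (∏ j, (((-lam - u j : ℤ)) : ZMod q)) *
        ∑ i, (c i : ZMod q) * ((lam + u i : ℤ) : ZMod q)⁻¹ := by
    rw [recipNumerator, eval_finsetSum, Int.cast_sum, Finset.sum_mul, Finset.mul_sum]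
    refine Finset.sum_congr rfl fun i _ => ?_
    rw [← Finset.mul_prod_erase _ _ (Finset.mem_univ i), eval_mul, eval_C, eval_prod]
    simp only [eval_sub, eval_X, eval_C]
    have := ZMod.mul_inv_of_unit _ (hu i)
    push_cast at this ⊢
    linear_combination (c i : ZMod q) * (∏ x ∈ Finset.univ.erase i, (-(lam : ZMod q) - u x)) * this
  rw [h, mul_zero, mul_neg_one, neg_eq_zero] at key
  exact key

/-- Each factor `L X + u i - u j` with `j ≠ i` is `u i - u j` times a polynomial with constant
term `1`. -/
lemma exists_recipNumerator_comp_eq (c u : ι → ℤ) (i : ι) (L : ℤ)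
    (hL : ∀ j, j ≠ i → u i - u j ∣ L) :
    ∃ R : ℤ[X], R.coeff 0 = c i ∧ (recipNumerator c u).comp (C L * X + C (u i)) =
      C (∏ j ∈ Finset.univ.erase i, (u i - u j)) * R := by
  choose! b hb using hL
  have hfac : ∀ s : Finset ι, i ∉ s → ∏ j ∈ s, (C L * X + C (u i) - C (u j)) =
      C (∏ j ∈ s, (u i - u j)) * ∏ j ∈ s, (1 + C (b j) * X) := by
    intro s hs
    rw [map_prod, ← Finset.prod_mul_distrib]
    refine Finset.prod_congr rfl fun j hj => ?_
    rw [hb j (by rintro rfl; exact hs hj), C_mul, C_sub]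
    ring
  refine ⟨C (c i) * ∏ j ∈ Finset.univ.erase i, (1 + C (b j) * X) +
    ∑ k ∈ Finset.univ.erase i, C (c k) * (C (b k) * X *
      ∏ j ∈ (Finset.univ.erase i).erase k, (1 + C (b j) * X)), ?_, ?_⟩
  · simp [coeff_zero_eq_eval_zero, eval_prod, eval_finsetSum]
  · rw [recipNumerator, ← coe_compRingHom_apply, map_sum,
      ← Finset.add_sum_erase _ _ (Finset.mem_univ i), mul_add, Finset.mul_sum]
    simp only [coe_compRingHom_apply]
    congr 1
    · rw [mul_comp, prod_comp, C_comp]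
      simp only [sub_comp, X_comp, C_comp]
      rw [hfac _ (by simp)]
      ring
    · refine Finset.sum_congr rfl fun k hk => ?_
      have hki := (Finset.mem_erase.1 hk).1
      rw [mul_comp, prod_comp, C_comp]
      simp only [sub_comp, X_comp, C_comp]
      have e1 : i ∈ Finset.univ.erase k := by simp [hki.symm]
      rw [← Finset.mul_prod_erase _ _ e1, Finset.erase_right_comm, hfac _ (by simp),
        ← Finset.mul_prod_erase _ _ hk, hb k hki, C_mul, C_mul]
      ring

/-- The arithmetic heart of the argument. After the substitution `X ↦ L X + u i` the numerator is a
constant multiple of a polynomial with constant term `c i`, whereas the content of `f (L X + u i)`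
divides `L ^ deg f` because `f` is primitive. -/
lemma eval_dvd_mul_pow_of_dvd_recipNumerator {f : ℤ[X]} (hf : f.IsPrimitive) {c u : ι → ℤ}
    (hu : Function.Injective u) (hfu : f ∣ recipNumerator c u) (i : ι) (L : ℤ)
    (hL : ∀ j, j ≠ i → u i - u j ∣ L) : f.eval (u i) ∣ c i * L ^ f.natDegree := by
  obtain ⟨R, hR0, hR⟩ := exists_recipNumerator_comp_eq c u i L hL
  set D := ∏ j ∈ Finset.univ.erase i, (u i - u j) with hD
  have hD0 : D ≠ 0 := Finset.prod_ne_zero_iff.2 fun j hj => sub_ne_zero.2 fun h =>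
    (Finset.mem_erase.1 hj).1 (hu h).symm
  set F := f.comp (C L * X + C (u i)) with hF
  have hF' : F = (f.comp (X + C (u i))).comp (C L * X) := by
    rw [hF, comp_assoc]; simp
  have hcont : F.content ∣ L ^ f.natDegree := by
    have h1 : C F.content ∣ C (L ^ f.natDegree) * f.comp (X + C (u i)) := by
      rw [C_dvd_iff_dvd_coeff]
      intro n
      rw [coeff_C_mul]
      rcases le_or_gt n f.natDegree with hn | hn
      · have h2 := content_dvd_coeff (p := F) n
        rw [hF', comp_C_mul_X_coeff, ← hF'] at h2
        refine h2.trans ?_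
        rw [mul_comm]
        exact mul_dvd_mul_right (pow_dvd_pow _ hn) _
      · rw [coeff_eq_zero_of_natDegree_lt, mul_zero]
        · exact dvd_zero _
        · rw [natDegree_comp, natDegree_X_add_C, mul_one]; exact hn
    have h3 : C F.content ∣ C (L ^ f.natDegree) * f := by
      obtain ⟨G, hG⟩ := h1
      refine ⟨G.comp (X - C (u i)), ?_⟩
      have := congrArg (fun p : ℤ[X] => p.comp (X - C (u i))) hG
      simpa [comp_assoc] using this
    rw [← dvd_content_iff_C_dvd, content_C_mul, hf.content_eq_one, mul_one] at h3
    exact (dvd_normalize_iff).1 h3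
  have hprim : F.primPart ∣ R := by
    rw [IsPrimitive.Int.dvd_iff_map_cast_dvd_map_cast _ _ (isPrimitive_primPart F)]
    have h1 : F.primPart ∣ C D * R := by
      rw [← hR]
      refine (primPart_dvd F).trans ?_
      obtain ⟨G, hG⟩ := hfu
      rw [hG, mul_comp]
      exact dvd_mul_right _ _
    have h2 := map_dvd (mapRingHom (Int.castRingHom ℚ)) h1
    rw [map_mul] at h2
    simp only [coe_mapRingHom, map_C] at h2
    refine (IsUnit.dvd_mul_left ?_).1 h2
    rw [isUnit_C]
    simpa using hD0
  have h0 : f.eval (u i) = F.content * F.primPart.coeff 0 := by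
    rw [← coeff_C_mul, ← eq_C_content_mul_primPart, coeff_zero_eq_eval_zero, hF, eval_comp]
    simp
  rw [h0, mul_comm (c i), ← hR0]
  obtain ⟨G, rfl⟩ := hprim
  refine mul_dvd_mul hcont ?_
  rw [mul_coeff_zero]
  exact dvd_mul_right _ _

end Numerator

/-! ### The size of the resultant -/

/-- Weighting the rows and columns of the Sylvester matrix by powers of `V` makes all its entries
at most `K`. -/
lemma abs_resultant_mul_pow_le (f g : ℤ[X]) (m n : ℕ) {K V : ℤ} (hV : 0 < V) (hK : 0 ≤ K)
    (hf : ∀ k, |f.coeff k| * V ^ k ≤ K) (hg : ∀ k, |g.coeff k| * V ^ k ≤ K) :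
    |resultant f g m n| * V ^ (m * n) ≤ (m + n).factorial * K ^ (m + n) := by
  set off : Fin (m + n) → ℕ := fun j => j.addCases (fun a => (a : ℕ)) (fun a => (a : ℕ)) with hoff
  have hentry : ∀ i j, |sylvester f g m n i j| * V ^ (i : ℕ) ≤ K * V ^ off j := by
    intro i j
    have h0 : 0 ≤ K * V ^ off j := by positivity
    induction j using Fin.addCases with
    | left j =>
      simp only [sylvester, Matrix.of_apply, Fin.addCases_left, hoff] at h0 ⊢
      split_ifs with h
      · have e : (i : ℕ) = (i - j) + j := by have := h.1; omega
        conv_lhs => enter [2]; rw [e]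
        rw [pow_add, ← mul_assoc]
        gcongr
        exact hg _
      · simpa using h0
    | right j =>
      simp only [sylvester, Matrix.of_apply, Fin.addCases_right, hoff] at h0 ⊢
      split_ifs with h
      · have e : (i : ℕ) = (i - j) + j := by have := h.1; omega
        conv_lhs => enter [2]; rw [e]
        rw [pow_add, ← mul_assoc]
        gcongr
        exact hf _
      · simpa using h0
  have hsum : ∑ j : Fin (m + n), (j : ℕ) = ∑ j, off j + m * n := by
    rw [Fin.sum_univ_add, Fin.sum_univ_add]
    simp [hoff, Finset.sum_add_distrib]
    ring
  have hperm : ∀ σ : Equiv.Perm (Fin (m + n)),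
      |∏ j, sylvester f g m n (σ j) j| * V ^ (m * n) ≤ K ^ (m + n) := by
    intro σ
    have h1 : ∏ j, (|sylvester f g m n (σ j) j| * V ^ (σ j : ℕ)) ≤ ∏ j, (K * V ^ off j) :=
      Finset.prod_le_prod (fun _ _ => by positivity) fun j _ => hentry _ _
    rw [Finset.prod_mul_distrib, Finset.prod_mul_distrib, Finset.prod_pow_eq_pow_sum,
      Finset.prod_pow_eq_pow_sum, Equiv.sum_comp σ (fun j => (j : ℕ)), hsum, pow_add,
      ← Finset.abs_prod, Finset.prod_const, Finset.card_univ, Fintype.card_fin] at h1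
    have h2 : 0 < V ^ ∑ j, off j := by positivity
    refine le_of_mul_le_mul_right ?_ h2
    calc _ = _ := by ring
      _ ≤ _ := h1
  rw [resultant, Matrix.det_apply]
  calc _ ≤ (∑ σ : Equiv.Perm (Fin (m + n)), |∏ j, sylvester f g m n (σ j) j|) * V ^ (m * n) := by
        gcongr
        refine (Finset.abs_sum_le_sum_abs _ _).trans (Finset.sum_le_sum fun σ _ => ?_)
        rw [Units.smul_def, smul_eq_mul, abs_mul]
        simp
    _ ≤ ∑ _σ : Equiv.Perm (Fin (m + n)), K ^ (m + n) := by
        rw [Finset.sum_mul]; exact Finset.sum_le_sum fun σ _ => hperm σ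
    _ = _ := by simp [Fintype.card_perm]

/-! ### Counting entries one at a time -/

/-- The least common multiple, over `t ∈ F`, of the part of `f v` dividing `v - t`. -/
def sharedModulus (f : ℤ[X]) (v : ℤ) (F : Finset ℤ) : ℕ :=
  F.lcm fun t => Int.gcd (f.eval v) (v - t)

/-- For real numbers `ρ k` standing for the roots of `f` and `L = sharedModulus f v F`, the sum
over `k` of `L / (L + |v - ρ k|)`. Up to constants, its reciprocal counts the candidates for `v`
which are as close as `v` to some `ρ k` and lie in the class of `v` modulo `L`. -/
noncomputable def rootWeight (f : ℤ[X]) (ρ : Fin f.natDegree → ℝ) (v : ℤ) (F : Finset ℤ) : ℝ :=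
  ∑ k, (sharedModulus f v F : ℝ) / (sharedModulus f v F + |(v : ℝ) - ρ k|)

lemma sharedModulus_pos {f : ℤ[X]} {v : ℤ} (hv : f.eval v ≠ 0) (F : Finset ℤ) :
    0 < sharedModulus f v F := by
  rw [Nat.pos_iff_ne_zero, sharedModulus, Ne, Finset.lcm_eq_zero_iff]
  rintro ⟨t, _, ht⟩
  exact hv (Int.gcd_eq_zero_iff.1 ht).1

lemma rootWeight_nonneg (f : ℤ[X]) (ρ : Fin f.natDegree → ℝ) (v : ℤ) (F : Finset ℤ) :
    0 ≤ rootWeight f ρ v F := Finset.sum_nonneg fun _ _ => by positivity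

/-- The residue of `v` modulo `sharedModulus f v F` is determined by the numbers
`gcd (f v, v - t)`, and each of these divides `f t`. -/
lemma sum_rootWeight_le {f : ℤ[X]} {ρ : Fin f.natDegree → ℝ} {V : ℕ} {τ : ℝ} {T F : Finset ℤ}
    (hρ : ∀ k, |ρ k| ≤ V) (hTV : ∀ v ∈ T, |v| ≤ V) (hT0 : ∀ v ∈ T, f.eval v ≠ 0)
    (hτ : ∀ v ∈ T, ((f.eval v).natAbs.divisors.card : ℝ) ≤ τ) (hF : F ⊆ T) :
    ∑ v ∈ T, rootWeight f ρ v F ≤ τ ^ F.card *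
      (f.natDegree * (2 * ∑ t ∈ Finset.range (2 * V + 1), (1 : ℝ) / (t + 1))) := by
  classical
  set g : ℤ → (t : ℤ) → t ∈ F → ℕ := fun v t _ => Int.gcd (f.eval v) (v - t) with hg
  set Δ := F.pi fun t => (f.eval t).natAbs.divisors with hΔ
  have hmaps : ∀ v ∈ T, g v ∈ Δ := by
    intro v _
    rw [hΔ, Finset.mem_pi]
    intro t ht
    rw [Nat.mem_divisors]
    refine ⟨?_, Int.natAbs_ne_zero.2 (hT0 t (hF ht))⟩
    rw [← Int.natCast_dvd]
    have h1 : (Int.gcd (f.eval v) (v - t) : ℤ) ∣ f.eval v := Int.gcd_dvd_left _ _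
    have h2 : (Int.gcd (f.eval v) (v - t) : ℤ) ∣ v - t := Int.gcd_dvd_right _ _
    have h3 := h2.trans (sub_dvd_eval_sub v t f)
    exact (dvd_sub_right h1).1 h3
  have hcard : (Δ.card : ℝ) ≤ τ ^ F.card := by
    rw [hΔ, Finset.card_pi, Nat.cast_prod, ← Finset.prod_const]
    exact Finset.prod_le_prod (fun _ _ => by positivity) fun t ht => hτ t (hF ht)
  have hfib : ∀ h ∈ Δ, ∑ v ∈ T with g v = h, rootWeight f ρ v F ≤
      f.natDegree * (2 * ∑ t ∈ Finset.range (2 * V + 1), (1 : ℝ) / (t + 1)) := by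
    intro h _
    rcases (T.filter fun v => g v = h).eq_empty_or_nonempty with he | ⟨v₀, hv₀⟩
    · rw [he, Finset.sum_empty]; positivity
    have hgt : ∀ v ∈ T.filter (fun v => g v = h), ∀ t ∈ F,
        Int.gcd (f.eval v) (v - t) = Int.gcd (f.eval v₀) (v₀ - t) := by
      intro v hv t ht
      have h1 : g v = g v₀ := (Finset.mem_filter.1 hv).2.trans (Finset.mem_filter.1 hv₀).2.symm
      exact congrFun (congrFun h1 t) ht
    have hmod : ∀ v ∈ T.filter (fun v => g v = h),
        sharedModulus f v F = sharedModulus f v₀ F := fun v hv =>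
      Finset.lcm_congr rfl fun t ht => hgt v hv t ht
    have hL := sharedModulus_pos (hT0 v₀ (Finset.mem_filter.1 hv₀).1) F
    calc _ = ∑ v ∈ T with g v = h, ∑ k, (sharedModulus f v₀ F : ℝ) /
          (sharedModulus f v₀ F + |(v : ℝ) - ρ k|) :=
          Finset.sum_congr rfl fun v hv => by rw [rootWeight, hmod v hv]
      _ = ∑ k, ∑ v ∈ T with g v = h, (sharedModulus f v₀ F : ℝ) /
          (sharedModulus f v₀ F + |(v : ℝ) - ρ k|) := Finset.sum_comm
      _ ≤ ∑ _k : Fin f.natDegree, 2 * ∑ t ∈ Finset.range (2 * V + 1), (1 : ℝ) / (t + 1) := by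
          refine Finset.sum_le_sum fun k _ => sum_div_add_abs_le hL (hρ k) _ ?_ fun v hv =>
            hTV v (Finset.mem_filter.1 hv).1
          intro v hv w hw
          rw [Int.natCast_dvd, sharedModulus]
          refine Finset.lcm_dvd fun t ht => ?_
          rw [← Int.natCast_dvd]
          have h1 : (Int.gcd (f.eval v₀) (v₀ - t) : ℤ) ∣ v - t := by
            rw [← hgt v hv t ht]; exact Int.gcd_dvd_right _ _
          have h2 : (Int.gcd (f.eval v₀) (v₀ - t) : ℤ) ∣ w - t := by
            rw [← hgt w hw t ht]; exact Int.gcd_dvd_right _ _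
          simpa using dvd_sub h1 h2
      _ = _ := by simp
  rw [← Finset.sum_fiberwise_of_maps_to hmaps]
  refine (Finset.sum_le_sum hfib).trans ?_
  rw [Finset.sum_const, nsmul_eq_mul]
  gcongr

/-- Summing over the entries one at a time, the first entry innermost. -/
lemma sum_piFinset_prod_le {α : Type*} [DecidableEq α] {T : Finset α} {w : α → Finset α → ℝ}
    (hw : ∀ v F, 0 ≤ w v F) {D : ℝ} {N : ℕ}
    (h : ∀ F ⊆ T, F.card ≤ N → ∑ v ∈ T, w v F ≤ D) (m : ℕ) (hm : m ≤ N) :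
    ∑ u ∈ Fintype.piFinset (fun _ : Fin m => T),
      ∏ i, w (u i) ((Finset.Ioi i).image u) ≤ D ^ m := by
  induction m with
  | zero => simp
  | succ m ih =>
    have hD : 0 ≤ D := (Finset.sum_nonneg fun v _ => hw v ∅).trans (h ∅ (by simp) (by simp))
    have hsplit : ∑ u ∈ Fintype.piFinset (fun _ : Fin (m + 1) => T),
        ∏ i, w (u i) ((Finset.Ioi i).image u) =
        ∑ u ∈ Fintype.piFinset (fun _ : Fin m => T), ∑ a ∈ T,
          w a (Finset.univ.image u) * ∏ i, w (u i) ((Finset.Ioi i).image u) := by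
      rw [← Finset.sum_product']
      refine Finset.sum_nbij' (fun u => (Fin.tail u, u 0)) (fun p => Fin.cons p.2 p.1) ?_ ?_ ?_ ?_ ?_
      · intro u hu
        rw [Fintype.mem_piFinset] at hu
        simp only [Finset.mem_product, Fintype.mem_piFinset]
        exact ⟨fun i => hu i.succ, hu 0⟩
      · rintro ⟨u, a⟩ hu
        simp only [Finset.mem_product, Fintype.mem_piFinset] at hu ⊢
        intro i
        induction i using Fin.cases with
        | zero => exact hu.2
        | succ i => exact hu.1 i
      · intro u _; exact Fin.cons_self_tail u
      · rintro ⟨u, a⟩ _; simp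
      · intro u _
        rw [Fin.prod_univ_succ]
        congr 1
        · congr 1
          ext x
          simp only [Finset.mem_image, Finset.mem_Ioi, Finset.mem_univ, true_and]
          constructor
          · rintro ⟨i, hi, rfl⟩
            exact ⟨i.pred hi.ne', by simp [Fin.tail]⟩
          · rintro ⟨i, rfl⟩
            exact ⟨i.succ, Fin.succ_pos i, rfl⟩
        · refine Finset.prod_congr rfl fun i _ => ?_
          congr 1
          ext x
          simp only [Finset.mem_image, Finset.mem_Ioi]
          constructor
          · rintro ⟨j, hj, rfl⟩
            have hj0 : j ≠ 0 := (lt_trans (Fin.succ_pos i) hj).ne'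
            refine ⟨j.pred hj0, ?_, by simp [Fin.tail]⟩
            rwa [← Fin.succ_lt_succ_iff, Fin.succ_pred]
          · rintro ⟨j, hj, rfl⟩
            exact ⟨j.succ, Fin.succ_lt_succ_iff.2 hj, rfl⟩
    rw [hsplit]
    calc _ = ∑ u ∈ Fintype.piFinset (fun _ : Fin m => T),
          (∑ a ∈ T, w a (Finset.univ.image u)) * ∏ i, w (u i) ((Finset.Ioi i).image u) := by
          simp_rw [Finset.sum_mul]
      _ ≤ ∑ u ∈ Fintype.piFinset (fun _ : Fin m => T),
          D * ∏ i, w (u i) ((Finset.Ioi i).image u) := by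
          refine Finset.sum_le_sum fun u hu => ?_
          refine mul_le_mul_of_nonneg_right (h _ ?_ ?_) (Finset.prod_nonneg fun _ _ => hw _ _)
          · intro x hx
            obtain ⟨i, _, rfl⟩ := Finset.mem_image.1 hx
            exact Fintype.mem_piFinset.1 hu i
          · refine Finset.card_image_le.trans ?_
            rw [Finset.card_univ, Fintype.card_fin]
            omega
      _ ≤ D ^ (m + 1) := by
          rw [← Finset.mul_sum, pow_succ']
          exact mul_le_mul_of_nonneg_left (ih (by omega)) hD

lemma sum_piFinset_prod_Iio_le {α : Type*} [DecidableEq α] {T : Finset α} {w : α → Finset α → ℝ}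
    (hw : ∀ v F, 0 ≤ w v F) {D : ℝ} {N : ℕ}
    (h : ∀ F ⊆ T, F.card ≤ N → ∑ v ∈ T, w v F ≤ D) (m : ℕ) (hm : m ≤ N) :
    ∑ u ∈ Fintype.piFinset (fun _ : Fin m => T),
      ∏ i, w (u i) ((Finset.Iio i).image u) ≤ D ^ m := by
  refine le_trans (le_of_eq ?_) (sum_piFinset_prod_le hw h m hm)
  refine Finset.sum_nbij' (fun u => u ∘ Fin.rev) (fun u => u ∘ Fin.rev) ?_ ?_ ?_ ?_ ?_
  · intro u hu
    rw [Fintype.mem_piFinset] at hu ⊢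
    exact fun i => hu _
  · intro u hu
    rw [Fintype.mem_piFinset] at hu ⊢
    exact fun i => hu _
  · intro u _; ext i; simp
  · intro u _; ext i; simp
  · intro u _
    refine Fintype.prod_equiv Fin.revPerm _ _ fun i => ?_
    simp only [Function.comp, Fin.revPerm_apply, Fin.rev_rev]
    congr 1
    ext x
    simp only [Finset.mem_image, Finset.mem_Iio, Finset.mem_Ioi]
    constructor
    · rintro ⟨j, hj, rfl⟩
      exact ⟨j.rev, Fin.rev_lt_rev.2 hj, by simp⟩
    · rintro ⟨j, hj, rfl⟩
      exact ⟨j.rev, by rwa [← Fin.rev_lt_rev, Fin.rev_rev], rfl⟩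

/-- The moduli which `u i` shares with the earlier and with the later entries together account for
all of `f (u i)`, so they cannot both be small compared with the distance from `u i` to the
nearest root of `f`. -/
lemma one_le_mul_rootWeight_mul_rootWeight {m : ℕ} {f : ℤ[X]} (hf : f.IsPrimitive)
    (hd : f.natDegree ≠ 0) {ρ : Fin f.natDegree → ℝ} {V B : ℕ} (hV : 1 ≤ V) (hB : 1 ≤ B)
    (hρ : ∀ k, |ρ k| ≤ V)
    (hρf : ∀ v : ℤ, |v| ≤ V → ∏ k, |(v : ℝ) - ρ k| ≤ |((f.eval v : ℤ) : ℝ)|)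
    {c u : Fin m → ℤ} (hu : Function.Injective u) (huV : ∀ i, |u i| ≤ V) (hc : ∀ i, c i ≠ 0)
    (hcB : ∀ i, |c i| ≤ B) (hfu : f ∣ recipNumerator c u) (i : Fin m) (hfi : f.eval (u i) ≠ 0) :
    1 ≤ ((5 + 2 * B) * V : ℝ) * (rootWeight f ρ (u i) ((Finset.Ioi i).image u) *
      rootWeight f ρ (u i) ((Finset.Iio i).image u)) := by
  set M := (f.eval (u i)).natAbs with hM
  set L₁ := sharedModulus f (u i) ((Finset.Ioi i).image u) with hL₁
  set L₂ := sharedModulus f (u i) ((Finset.Iio i).image u) with hL₂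
  have hL₁0 : 0 < L₁ := sharedModulus_pos hfi _
  have hL₂0 : 0 < L₂ := sharedModulus_pos hfi _
  have hL₁1 : (1 : ℝ) ≤ L₁ := by exact_mod_cast hL₁0
  have hL₂1 : (1 : ℝ) ≤ L₂ := by exact_mod_cast hL₂0
  have hV' : (1 : ℝ) ≤ V := by exact_mod_cast hV
  have hB' : (1 : ℝ) ≤ B := by exact_mod_cast hB
  have hsize : M ≤ B * (L₁ * L₂) ^ f.natDegree := by
    set Λ := (Finset.univ.erase i).lcm fun j => (u i - u j).natAbs with hΛ
    have h1 : M ∣ (c i).natAbs * Λ ^ f.natDegree := by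
      have := eval_dvd_mul_pow_of_dvd_recipNumerator hf hu hfu i (Λ : ℤ) fun j hj => by
        rw [← Int.natAbs_dvd, Int.natCast_dvd_natCast]
        exact Finset.dvd_lcm (f := fun j => (u i - u j).natAbs) (by simp [hj])
      have := Int.natAbs_dvd_natAbs.2 this
      rwa [Int.natAbs_mul, Int.natAbs_pow, Int.natAbs_natCast] at this
    have h2 : M ∣ (c i).natAbs * (Nat.gcd M Λ) ^ f.natDegree := by
      have h3 : M ∣ (c i).natAbs * M ^ f.natDegree := (dvd_pow_self M hd).mul_left _
      have := Nat.dvd_gcd h3 h1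
      rwa [Nat.gcd_mul_left, Nat.pow_gcd_pow] at this
    have h3 : Nat.gcd M Λ ∣ L₁ * L₂ := by
      refine (gcd_finset_lcm_dvd _ _ _).trans (Finset.lcm_dvd fun j hj => ?_)
      have e : M.gcd (u i - u j).natAbs = Int.gcd (f.eval (u i)) (u i - u j) := rfl
      rw [e]
      rcases lt_or_gt_of_ne (Finset.mem_erase.1 hj).1 with h | h
      · exact (Finset.dvd_lcm (f := fun t => Int.gcd (f.eval (u i)) (u i - t))
          (Finset.mem_image_of_mem u (Finset.mem_Iio.2 h))).mul_left _
      · exact (Finset.dvd_lcm (f := fun t => Int.gcd (f.eval (u i)) (u i - t))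
          (Finset.mem_image_of_mem u (Finset.mem_Ioi.2 h))).mul_right _
    have h4 : M ∣ (c i).natAbs * (L₁ * L₂) ^ f.natDegree :=
      h2.trans (mul_dvd_mul_left _ (pow_dvd_pow_of_dvd h3 _))
    have hc0 : 0 < (c i).natAbs := Int.natAbs_pos.2 (hc i)
    refine (Nat.le_of_dvd (by positivity) h4).trans (Nat.mul_le_mul_right _ ?_)
    have : ((c i).natAbs : ℤ) ≤ B := by rw [Int.natCast_natAbs]; exact hcB i
    exact_mod_cast this
  obtain ⟨k, hk⟩ : ∃ k, |(u i : ℝ) - ρ k| ≤ B * (L₁ * L₂) := by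
    by_contra! hcon
    have hne : (Finset.univ : Finset (Fin f.natDegree)).Nonempty := ⟨⟨0, by omega⟩, by simp⟩
    have h1 : (B * (L₁ * L₂) : ℝ) ^ f.natDegree < |((f.eval (u i) : ℤ) : ℝ)| := by
      refine lt_of_lt_of_le ?_ (hρf _ (huV i))
      calc (B * (L₁ * L₂) : ℝ) ^ f.natDegree = ∏ _k : Fin f.natDegree, (B * (L₁ * L₂) : ℝ) := by simp
        _ < _ := Finset.prod_lt_prod_of_nonempty (fun _ _ => by positivity) (fun k _ => hcon k) hne
    have h2 : |((f.eval (u i) : ℤ) : ℝ)| ≤ B * (L₁ * L₂) ^ f.natDegree := by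
      have : ((M : ℕ) : ℝ) = |((f.eval (u i) : ℤ) : ℝ)| := by rw [hM, Nat.cast_natAbs]; simp
      rw [← this]
      exact_mod_cast hsize
    rw [mul_pow] at h1
    have h3 : (B : ℝ) ≤ (B : ℝ) ^ f.natDegree := le_self_pow₀ hB' hd
    have h4 : (0 : ℝ) ≤ ((L₁ : ℝ) * L₂) ^ f.natDegree := by positivity
    nlinarith
  set x := |(u i : ℝ) - ρ k| with hx
  have hx0 : 0 ≤ x := abs_nonneg _
  have hxV : x ≤ 2 * V := by
    have h1 : |(u i : ℝ)| ≤ V := by exact_mod_cast huV i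
    have := abs_sub (u i : ℝ) (ρ k)
    linarith [hρ k]
  have hw₁ : (L₁ : ℝ) / (L₁ + x) ≤ rootWeight f ρ (u i) ((Finset.Ioi i).image u) :=
    Finset.single_le_sum (f := fun k => (L₁ : ℝ) / (L₁ + |(u i : ℝ) - ρ k|))
      (fun _ _ => by positivity) (Finset.mem_univ k)
  have hw₂ : (L₂ : ℝ) / (L₂ + x) ≤ rootWeight f ρ (u i) ((Finset.Iio i).image u) :=
    Finset.single_le_sum (f := fun k => (L₂ : ℝ) / (L₂ + |(u i : ℝ) - ρ k|))
      (fun _ _ => by positivity) (Finset.mem_univ k)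
  have hmul := mul_le_mul hw₁ hw₂ (by positivity) (rootWeight_nonneg _ _ _ _)
  refine le_trans ?_ (mul_le_mul_of_nonneg_left hmul (by positivity))
  rw [div_mul_div_comm, mul_div_assoc', le_div_iff₀ (by positivity), one_mul]
  have hLL : (1 : ℝ) ≤ L₁ * L₂ := by nlinarith
  have e1 : (L₁ : ℝ) * x ≤ (L₁ * L₂) * (2 * V) := by
    calc (L₁ : ℝ) * x ≤ (L₁ * L₂) * x := by
          apply mul_le_mul_of_nonneg_right _ hx0; nlinarith
      _ ≤ _ := by gcongr
  have e2 : (L₂ : ℝ) * x ≤ (L₁ * L₂) * (2 * V) := by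
    calc (L₂ : ℝ) * x ≤ (L₁ * L₂) * x := by
          apply mul_le_mul_of_nonneg_right _ hx0; nlinarith
      _ ≤ _ := by gcongr
  have e3 : x * x ≤ B * (L₁ * L₂) * (2 * V) := mul_le_mul hk hxV hx0 (by positivity)
  have e4 : (L₁ * L₂ : ℝ) ≤ L₁ * L₂ * V := le_mul_of_one_le_right (by positivity) hV'
  calc (L₁ + x) * (L₂ + x) = L₁ * L₂ + L₁ * x + L₂ * x + x * x := by ring
    _ ≤ L₁ * L₂ * V + (L₁ * L₂) * (2 * V) + (L₁ * L₂) * (2 * V) + B * (L₁ * L₂) * (2 * V) := by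
      linarith
    _ = _ := by ring

/-- Every admissible tuple has large total weight in one of the two orders. -/
lemma card_le_of_dvd_recipNumerator {m N : ℕ} (hmN : m ≤ N) {f : ℤ[X]} (hf : f.IsPrimitive)
    (hd : f.natDegree ≠ 0) {V B : ℕ} (hV : 1 ≤ V) (hB : 1 ≤ B) {τ : ℝ} (hτ1 : 1 ≤ τ)
    {c : Fin m → ℤ} (hc : ∀ i, c i ≠ 0) (hcB : ∀ i, |c i| ≤ B) (S : Finset (Fin m → ℤ))
    (hS : ∀ u ∈ S, Function.Injective u ∧ (∀ i, |u i| ≤ V) ∧ f ∣ recipNumerator c u)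
    (hτ : ∀ u ∈ S, ∀ i, ((f.eval (u i)).natAbs.divisors.card : ℝ) ≤ τ) :
    (S.card : ℝ) ≤ √((5 + 2 * B) * V) ^ m * (2 * (τ ^ N * (f.natDegree *
      (2 * ∑ t ∈ Finset.range (2 * V + 1), (1 : ℝ) / (t + 1)))) ^ m) := by
  classical
  set H := ∑ t ∈ Finset.range (2 * V + 1), (1 : ℝ) / (t + 1) with hH
  set D := τ ^ N * (f.natDegree * (2 * H)) with hD
  obtain ⟨ρ, hρ, hρf⟩ := exists_real_prod_abs_sub_le_abs_eval hf.ne_zero V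
  set T := (Finset.Icc (-(V : ℤ)) V).filter fun v =>
    f.eval v ≠ 0 ∧ ((f.eval v).natAbs.divisors.card : ℝ) ≤ τ with hT
  have hH0 : 0 ≤ H := Finset.sum_nonneg fun _ _ => by positivity
  have hroot : ∀ u ∈ S, ∀ i, f.eval (u i) ≠ 0 := by
    intro u hu i h0
    have h1 := eval_recipNumerator_ne_zero (hS u hu).1 (hc i)
    obtain ⟨g, hg⟩ := (hS u hu).2.2
    rw [hg, eval_mul, h0, zero_mul] at h1
    exact h1 rfl
  have hST : ∀ u ∈ S, u ∈ Fintype.piFinset fun _ : Fin m => T := by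
    intro u hu
    rw [Fintype.mem_piFinset]
    intro i
    rw [hT, Finset.mem_filter, Finset.mem_Icc]
    exact ⟨abs_le.1 ((hS u hu).2.1 i), hroot u hu i, hτ u hu i⟩
  have hstep : ∀ F ⊆ T, F.card ≤ N → ∑ v ∈ T, rootWeight f ρ v F ≤ D := by
    intro F hF hFN
    refine (sum_rootWeight_le (V := V) (τ := τ) hρ (fun v hv => ?_) (fun v hv => ?_)
      (fun v hv => ?_) hF).trans ?_
    · exact abs_le.2 (Finset.mem_Icc.1 (Finset.mem_filter.1 hv).1)
    · exact (Finset.mem_filter.1 hv).2.1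
    · exact (Finset.mem_filter.1 hv).2.2
    · exact mul_le_mul_of_nonneg_right (pow_le_pow_right₀ hτ1 hFN) (by positivity)
  have h₁ := sum_piFinset_prod_le (rootWeight_nonneg f ρ) hstep m hmN
  have h₂ := sum_piFinset_prod_Iio_le (rootWeight_nonneg f ρ) hstep m hmN
  set W₁ : (Fin m → ℤ) → ℝ := fun u => ∏ i, rootWeight f ρ (u i) ((Finset.Ioi i).image u)
  set W₂ : (Fin m → ℤ) → ℝ := fun u => ∏ i, rootWeight f ρ (u i) ((Finset.Iio i).image u)
  have hW₁ : ∀ u, 0 ≤ W₁ u := fun u => Finset.prod_nonneg fun _ _ => rootWeight_nonneg _ _ _ _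
  have hW₂ : ∀ u, 0 ≤ W₂ u := fun u => Finset.prod_nonneg fun _ _ => rootWeight_nonneg _ _ _ _
  set K := √((5 + 2 * B) * V : ℝ) ^ m with hK
  have hK0 : 0 ≤ K := by positivity
  have hpt : ∀ u ∈ S, 1 ≤ K * (W₁ u + W₂ u) := by
    intro u hu
    have h1 : (1 : ℝ) ≤ K ^ 2 * (W₁ u * W₂ u) := by
      have e : K ^ 2 = ((5 + 2 * B) * V : ℝ) ^ m := by
        rw [hK, ← pow_mul, mul_comm m 2, pow_mul, Real.sq_sqrt (by positivity)]
      calc (1 : ℝ) = ∏ _i : Fin m, (1 : ℝ) := by simp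
        _ ≤ ∏ i, ((5 + 2 * B) * V : ℝ) * (rootWeight f ρ (u i) ((Finset.Ioi i).image u) *
            rootWeight f ρ (u i) ((Finset.Iio i).image u)) :=
          Finset.prod_le_prod (fun _ _ => zero_le_one) fun i _ =>
            one_le_mul_rootWeight_mul_rootWeight hf hd hV hB hρ hρf (hS u hu).1 (hS u hu).2.1 hc
              hcB (hS u hu).2.2 i (hroot u hu i)
        _ = _ := by
          simp only [e, W₁, W₂, Finset.prod_mul_distrib, Finset.prod_const, Finset.card_univ,
            Fintype.card_fin, mul_pow]
    by_contra! hlt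
    have h3 : 0 ≤ K * (W₁ u + W₂ u) := mul_nonneg hK0 (add_nonneg (hW₁ u) (hW₂ u))
    have h4 : K ^ 2 * (4 * (W₁ u * W₂ u)) ≤ K ^ 2 * (W₁ u + W₂ u) ^ 2 := by
      gcongr
      nlinarith [sq_nonneg (W₁ u - W₂ u)]
    have h5 : (K * (W₁ u + W₂ u)) ^ 2 < 1 := by nlinarith
    rw [mul_pow] at h5
    linarith
  calc (S.card : ℝ) = ∑ u ∈ S, (1 : ℝ) := by simp
    _ ≤ ∑ u ∈ S, K * (W₁ u + W₂ u) := Finset.sum_le_sum hpt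
    _ ≤ ∑ u ∈ Fintype.piFinset fun _ : Fin m => T, K * (W₁ u + W₂ u) :=
        Finset.sum_le_sum_of_subset_of_nonneg hST fun u _ _ =>
          mul_nonneg hK0 (add_nonneg (hW₁ u) (hW₂ u))
    _ = K * (∑ u ∈ Fintype.piFinset fun _ : Fin m => T, W₁ u +
          ∑ u ∈ Fintype.piFinset fun _ : Fin m => T, W₂ u) := by
        rw [← Finset.mul_sum, Finset.sum_add_distrib]
    _ ≤ K * (2 * D ^ m) := by
        refine mul_le_mul_of_nonneg_left ?_ hK0
        linarith

/-! ### Common roots of numerators -/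

lemma exists_irreducible_dvd_of_aeval_eq_zero {P : ℤ[X]} (hP : P ≠ 0) {β : ℂ}
    (hβ : aeval β P = 0) : ∃ f : ℤ[X], Irreducible f ∧ f ∣ P ∧ aeval β f = 0 := by
  obtain ⟨s, hs, hsP⟩ := UniqueFactorizationMonoid.exists_prime_factors P hP
  have h0 : aeval β s.prod = 0 := by
    obtain ⟨w, hw⟩ := hsP.symm
    rw [← hw, map_mul, hβ, zero_mul]
  rw [map_multiset_prod, Multiset.prod_eq_zero_iff, Multiset.mem_map] at h0
  obtain ⟨f, hf, hf0⟩ := h0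
  exact ⟨f, (hs f hf).irreducible, (Multiset.dvd_prod hf).trans hsP.dvd, hf0⟩

lemma natDegree_ne_zero_of_aeval_eq_zero {f : ℤ[X]} (hf : Irreducible f) {β : ℂ}
    (hβ : aeval β f = 0) : f.natDegree ≠ 0 := by
  intro h
  rw [eq_C_of_natDegree_eq_zero h, aeval_C] at hβ
  have : f.coeff 0 = 0 := by simpa using hβ
  apply hf.ne_zero
  rw [eq_C_of_natDegree_eq_zero h, this, C_0]

lemma dvd_of_aeval_eq_zero {f P : ℤ[X]} (hf : Irreducible f) {β : ℂ} (hβ : aeval β f = 0)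
    (hP : aeval β P = 0) : f ∣ P := by
  have hprim := hf.isPrimitive (natDegree_ne_zero_of_aeval_eq_zero hf hβ)
  rw [IsPrimitive.Int.dvd_iff_map_cast_dvd_map_cast _ _ hprim]
  have hirr := (IsPrimitive.Int.irreducible_iff_irreducible_map_cast hprim).1 hf
  rcases (dvd_or_isCoprime _ (P.map (Int.castRingHom ℚ)) hirr).symm with h | h
  · exfalso
    have h1 : ∀ Q : ℤ[X], aeval β (Q.map (Int.castRingHom ℚ)) = aeval β Q := fun Q =>
      aeval_map_algebraMap ℚ β Q
    rcases aeval_ne_zero_of_isCoprime h β with h2 | h2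
    · exact h2 ((h1 f).trans hβ)
    · exact h2 ((h1 P).trans hP)
  · exact h

/-- A constant `c` such that two numerators built from at most `N` points of absolute value at
most `V` have resultant at most `c * V ^ (N * (N - 2))`. -/
def resultantConst (N : ℕ) : ℕ := (2 * N).factorial * (N * (N * 2 ^ N)) ^ (2 * N)

section CommonRoot

variable {N m q V : ℕ} {lam : ℤ} {c u u' : Fin m → ℤ}

lemma abs_coeff_recipNumerator_mul_pow_le (hmN : m ≤ N) (hV : 1 ≤ V) (hcN : ∀ i, |c i| ≤ N)
    (hu : ∀ i, |u i| ≤ V) (t : ℕ) :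
    |(recipNumerator c u).coeff t| * (V : ℤ) ^ t ≤ (N * (N * 2 ^ N) : ℤ) * (V : ℤ) ^ (m - 1) := by
  refine (abs_coeff_recipNumerator_le (by positivity) hu hcN t).trans ?_
  rw [Fintype.card_fin, mul_pow]
  have h1 : (2 : ℤ) ^ (m - 1) ≤ 2 ^ N := pow_le_pow_right₀ (by norm_num) (by omega)
  have h2 : (m : ℤ) ≤ N := by exact_mod_cast hmN
  calc (m : ℤ) * (N * (2 ^ (m - 1) * (V : ℤ) ^ (m - 1)))
      ≤ N * (N * (2 ^ N * (V : ℤ) ^ (m - 1))) := by gcongr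
    _ = _ := by ring

/-- Two numerators with the common root `x` modulo `q` have resultant divisible by `q`. If the
coefficients are small compared with `q`, the resultant is then zero. -/
lemma exists_common_root_recipNumerator (hN : 4 ≤ N) (hm : 2 ≤ m) (hmN : m ≤ N) (hV : 1 ≤ V)
    (hq : resultantConst N * V ^ (N * (N - 2)) < q) (hc : ∀ i, c i ≠ 0) (hcN : ∀ i, |c i| ≤ N)
    (hc0 : ∑ i, c i = 0) (hu : Function.Injective u) (hu' : Function.Injective u')
    (huV : ∀ i, |u i| ≤ V) (huV' : ∀ i, |u' i| ≤ V) {x : ℤ}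
    (hx : (((recipNumerator c u).eval x : ℤ) : ZMod q) = 0)
    (hx' : (((recipNumerator c u').eval x : ℤ) : ZMod q) = 0) :
    ∃ β : ℂ, aeval β (recipNumerator c u) = 0 ∧ aeval β (recipNumerator c u') = 0 := by
  set P := recipNumerator c u with hP
  set Q := recipNumerator c u' with hQ
  have hP0 : P ≠ 0 := fun h => by
    have := eval_recipNumerator_ne_zero hu (hc ⟨0, by omega⟩)
    rw [← hP, h, eval_zero] at this
    exact this rfl
  have hdP : P.natDegree < m - 1 := by
    simpa using natDegree_recipNumerator_lt (u := u) hc0 (by simpa using hm)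
  have hdQ : Q.natDegree < m - 1 := by
    simpa using natDegree_recipNumerator_lt (u := u') hc0 (by simpa using hm)
  have hcP := abs_coeff_recipNumerator_mul_pow_le hmN hV hcN huV
  have hcQ := abs_coeff_recipNumerator_mul_pow_le hmN hV hcN huV'
  have hV' : (1 : ℤ) ≤ V := by exact_mod_cast hV
  set κ : ℤ := N * (N * 2 ^ N) with hκ
  have hκ1 : 1 ≤ κ := by
    have h1 : (1 : ℤ) ≤ N := by exact_mod_cast (by omega : 1 ≤ N)
    have h2 : (1 : ℤ) ≤ 2 ^ N := one_le_pow₀ (by norm_num)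
    exact one_le_mul_of_one_le_of_one_le h1 (one_le_mul_of_one_le_of_one_le h1 h2)
  have hconst : (resultantConst N : ℤ) = (2 * N).factorial * κ ^ (2 * N) := by
    rw [resultantConst, hκ]; push_cast; ring
  have hq' : (2 * N).factorial * κ ^ (2 * N) * (V : ℤ) ^ (N * (N - 2)) < q := by
    rw [← hconst]; exact_mod_cast hq
  have hfac : ∀ k : ℕ, (1 : ℤ) ≤ k.factorial := fun k => by exact_mod_cast Nat.factorial_pos k
  by_cases hdeg : P.natDegree = 0 ∧ Q.natDegree = 0
  · -- A nonzero constant numerator is too small to be divisible by `q`.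
    exfalso
    have e := eq_C_of_natDegree_eq_zero hdeg.1
    rw [e, eval_C, ZMod.intCast_zmod_eq_zero_iff_dvd] at hx
    have h1 : |P.coeff 0| < q := by
      refine lt_of_le_of_lt ?_ hq'
      have h2 := hcP 0
      rw [pow_zero, mul_one] at h2
      refine h2.trans ?_
      have h3 : m - 1 ≤ N * (N - 2) := by
        have : N * 2 ≤ N * (N - 2) := Nat.mul_le_mul_left _ (by omega)
        omega
      calc κ * (V : ℤ) ^ (m - 1) ≤ κ * (V : ℤ) ^ (N * (N - 2)) := by gcongr
        _ ≤ κ ^ (2 * N) * (V : ℤ) ^ (N * (N - 2)) := by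
          gcongr; exact le_self_pow₀ hκ1 (by omega)
        _ ≤ _ := by
          gcongr; exact le_mul_of_one_le_left (by positivity) (hfac _)
    have h0 := Int.eq_zero_of_abs_lt_dvd hx h1
    rw [h0, C_0] at e
    exact hP0 e
  have hres : resultant P Q = 0 := by
    set a := P.natDegree
    set b := Q.natDegree
    obtain ⟨p₁, p₂, -, -, h⟩ := exists_mul_add_mul_eq_C_resultant P Q le_rfl le_rfl
      (by rw [Ne, Ne, ← not_and_or]; exact hdeg)
    have hdvd : (q : ℤ) ∣ resultant P Q a b := by
      rw [← ZMod.intCast_zmod_eq_zero_iff_dvd]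
      have := congrArg (fun p : ℤ[X] => ((p.eval x : ℤ) : ZMod q)) h
      simp only [eval_add, eval_mul, eval_C, Int.cast_add, Int.cast_mul, hx, hx', zero_mul,
        add_zero] at this
      exact this.symm
    refine Int.eq_zero_of_abs_lt_dvd hdvd (lt_of_le_of_lt ?_ hq')
    have h1 := abs_resultant_mul_pow_le P Q a b (V := V) (by positivity)
      (K := κ * (V : ℤ) ^ (m - 1)) (by positivity) hcP hcQ
    obtain ⟨A, rfl⟩ : ∃ A, m = A + 2 := ⟨m - 2, by omega⟩
    obtain ⟨M, rfl⟩ : ∃ M, N = M + 2 := ⟨N - 2, by omega⟩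
    have ha : a ≤ A := by omega
    have hb : b ≤ A := by omega
    -- `(A + 1 - a) * (A + 1 - b) ≥ 1` bounds the exponent of `V`
    have hexp : (A + 1) * (a + b) ≤ (M + 2) * M + a * b := by
      have h2 : (A + 2) * A ≤ (M + 2) * M := Nat.mul_le_mul (by omega) (by omega)
      have h3 : (A + 1) * (a + b) ≤ (A + 2) * A + a * b := by
        zify at ha hb ⊢
        nlinarith [mul_nonneg (sub_nonneg.2 ha) (sub_nonneg.2 hb)]
      omega
    have h2 : 0 < (V : ℤ) ^ (a * b) := by positivity
    refine le_of_mul_le_mul_right (h1.trans ?_) h2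
    rw [mul_pow, ← pow_mul]
    calc ((a + b).factorial : ℤ) * (κ ^ (a + b) * (V : ℤ) ^ ((A + 2 - 1) * (a + b)))
        ≤ (2 * (M + 2)).factorial * (κ ^ (2 * (M + 2)) * (V : ℤ) ^ ((M + 2) * M + a * b)) := by
          have e1 : a + b ≤ 2 * (M + 2) := by omega
          gcongr
          exact hexp
      _ = _ := by rw [pow_add]; simp only [Nat.add_sub_cancel]; ring
  have hinj : Function.Injective (algebraMap ℤ ℂ) := Int.cast_injective
  have hres' : resultant (P.map (algebraMap ℤ ℂ)) (Q.map (algebraMap ℤ ℂ)) = 0 := by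
    rw [natDegree_map_eq_of_injective hinj, natDegree_map_eq_of_injective hinj,
      resultant_map_map, hres, map_zero]
  have hcop := (resultant_eq_zero_iff.1 hres').2
  rw [isCoprime_iff_aeval_ne_zero_of_isAlgClosed ℂ ℂ] at hcop
  push Not at hcop
  obtain ⟨β, h1, h2⟩ := hcop
  refine ⟨β, ?_, ?_⟩
  · rwa [coe_aeval_eq_eval, eval_map_algebraMap] at h1
  · rwa [coe_aeval_eq_eval, eval_map_algebraMap] at h2

end CommonRoot

/-! ### Injective solutions in a short interval -/

lemma one_le_sum_one_div (V : ℕ) :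
    1 ≤ ∑ t ∈ Finset.range (2 * V + 1), (1 : ℝ) / (t + 1) := by
  rw [Finset.sum_range_succ']
  have : 0 ≤ ∑ t ∈ Finset.range (2 * V), (1 : ℝ) / ((t + 1 : ℕ) + 1) :=
    Finset.sum_nonneg fun _ _ => by positivity
  simpa using this

lemma sum_one_div_le_mul_rpow {η : ℝ} (hη : 0 < η) {V : ℕ} (hV : 1 ≤ V) :
    ∑ t ∈ Finset.range (2 * V + 1), (1 : ℝ) / (t + 1) ≤ (1 + 3 ^ η / η) * (V : ℝ) ^ η := by
  have hV' : (1 : ℝ) ≤ V := by exact_mod_cast hV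
  have h1 := harmonic_le_one_add_log (2 * V + 1)
  have h2 : ((harmonic (2 * V + 1) : ℚ) : ℝ) =
      ∑ t ∈ Finset.range (2 * V + 1), (1 : ℝ) / (t + 1) := by
    rw [harmonic]
    push_cast
    simp
  rw [h2] at h1
  refine h1.trans ?_
  have h3 : Real.log ((2 * V + 1 : ℕ) : ℝ) ≤ (3 * V : ℝ) ^ η / η := by
    refine le_trans (Real.log_le_log (by positivity) ?_) (Real.log_le_rpow_div (by positivity) hη)
    push_cast; linarith
  rw [Real.mul_rpow (by norm_num) (by positivity)] at h3
  have h4 : (1 : ℝ) ≤ (V : ℝ) ^ η := Real.one_le_rpow hV' hη.le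
  calc _ ≤ (V : ℝ) ^ η + 3 ^ η * (V : ℝ) ^ η / η := add_le_add h4 h3
    _ = _ := by ring

/-- The divisor and harmonic factors are together at most an arbitrarily small power of `V`. -/
lemma exists_divisor_harmonic_bound (N : ℕ) (hN : 1 ≤ N) (ε : ℝ) (hε : 0 < ε) :
    ∃ C : ℝ, 1 ≤ C ∧ ∀ V : ℕ, 1 ≤ V → ∃ τ : ℝ, 1 ≤ τ ∧
      (∀ n : ℕ, n ≤ N * (2 * V) ^ N → (n.divisors.card : ℝ) ≤ τ) ∧
      (τ ^ N * (N * (2 * ∑ t ∈ Finset.range (2 * V + 1), (1 : ℝ) / (t + 1)))) ^ N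
        ≤ C * (V : ℝ) ^ ε := by
  have hN' : (1 : ℝ) ≤ N := by exact_mod_cast hN
  set δ : ℝ := ε / (2 * N ^ 3) with hδ
  set η : ℝ := ε / (2 * N) with hη
  have hδ0 : 0 < δ := by positivity
  have hη0 : 0 < η := by positivity
  obtain ⟨C₁, hC₁, hdiv⟩ := card_divisors_le_mul_rpow δ hδ0
  set a : ℝ := C₁ * (N * 2 ^ N : ℝ) ^ δ with ha
  set b : ℝ := 1 + 3 ^ η / η with hb
  have ha1 : 1 ≤ a := one_le_mul_of_one_le_of_one_le hC₁
    (Real.one_le_rpow (one_le_mul_of_one_le_of_one_le hN' (one_le_pow₀ (by norm_num))) hδ0.le)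
  have hb1 : 1 ≤ b := by rw [hb]; have : 0 ≤ (3 : ℝ) ^ η / η := by positivity
                         linarith
  have hbase : 1 ≤ a ^ N * (N * (2 * b)) := one_le_mul_of_one_le_of_one_le (one_le_pow₀ ha1)
    (one_le_mul_of_one_le_of_one_le hN' (by linarith))
  refine ⟨(a ^ N * (N * (2 * b))) ^ N, one_le_pow₀ hbase, fun V hV => ?_⟩
  have hV' : (1 : ℝ) ≤ V := by exact_mod_cast hV
  have hV0 : (0 : ℝ) < V := by linarith
  refine ⟨a * (V : ℝ) ^ (N * δ), one_le_mul_of_one_le_of_one_le ha1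
    (Real.one_le_rpow hV' (by positivity)), fun n hn => ?_, ?_⟩
  · calc (n.divisors.card : ℝ) ≤ C₁ * (n : ℝ) ^ δ := hdiv n
      _ ≤ C₁ * ((N * 2 ^ N : ℝ) * (V : ℝ) ^ N) ^ δ := by
          gcongr
          calc (n : ℝ) ≤ ((N * (2 * V) ^ N : ℕ) : ℝ) := by exact_mod_cast hn
            _ = _ := by push_cast; ring
      _ = _ := by
          rw [Real.mul_rpow (by positivity) (by positivity),
            ← Real.rpow_natCast_mul (by positivity)]
          ring
  · calc _ ≤ ((a * (V : ℝ) ^ (N * δ)) ^ N * (N * (2 * (b * (V : ℝ) ^ η)))) ^ N := by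
          gcongr
          exact sum_one_div_le_mul_rpow hη0 hV
      _ = (a ^ N * (N * (2 * b))) ^ N * ((V : ℝ) ^ (N * δ * N * N) * (V : ℝ) ^ (η * N)) := by
          rw [Real.rpow_mul_natCast (by positivity), Real.rpow_mul_natCast (by positivity),
            Real.rpow_mul_natCast (by positivity)]
          ring_nf
      _ = _ := by
          rw [← Real.rpow_add hV0]
          congr 2
          rw [hδ, hη]
          field_simp
          ring

/-- Injective solutions of `∑ i, c i / (lam + u i) ≡ 0 (mod q)` in a short interval: all the
numerators vanish at one of at most `N` algebraic numbers `β`, and for each `β` they are all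
divisible by its irreducible integer polynomial. -/
lemma card_injective_solutions_le (N : ℕ) (hN : 4 ≤ N) (ε : ℝ) (hε : 0 < ε) :
    ∃ C : ℝ, 1 ≤ C ∧ ∀ (m q V : ℕ) (lam : ℤ) (c : Fin m → ℤ) (S : Finset (Fin m → ℤ)),
      m ≤ N → 1 ≤ V → resultantConst N * V ^ (N * (N - 2)) < q →
      (∀ i, c i ≠ 0) → (∀ i, |c i| ≤ N) → ∑ i, c i = 0 →
      (∀ u ∈ S, Function.Injective u ∧ (∀ i, |u i| ≤ V) ∧
        (∀ i, IsUnit ((lam + u i : ℤ) : ZMod q)) ∧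
        ∑ i, (c i : ZMod q) * ((lam + u i : ℤ) : ZMod q)⁻¹ = 0) →
      (S.card : ℝ) ≤ C * (V : ℝ) ^ ε * √V ^ m := by
  classical
  obtain ⟨C₁, hC₁, hbd⟩ := exists_divisor_harmonic_bound N (by omega) ε hε
  have hN' : (1 : ℝ) ≤ N := by exact_mod_cast (by omega : 1 ≤ N)
  have hroot1 : 1 ≤ √(5 + 2 * N : ℝ) := Real.one_le_sqrt.2 (by linarith)
  have hrootN : 1 ≤ √(5 + 2 * N : ℝ) ^ N := one_le_pow₀ hroot1
  have hCC : 1 ≤ N * (√(5 + 2 * N : ℝ) ^ N * (2 * C₁)) :=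
    one_le_mul_of_one_le_of_one_le hN' (one_le_mul_of_one_le_of_one_le hrootN (by linarith))
  refine ⟨N * (√(5 + 2 * N : ℝ) ^ N * (2 * C₁)), hCC,
    fun m q V lam c S hmN hV hq hc hcN hc0 hS => ?_⟩
  have hV' : (1 : ℝ) ≤ V := by exact_mod_cast hV
  have hrhs : 1 ≤ N * (√(5 + 2 * N : ℝ) ^ N * (2 * C₁)) * (V : ℝ) ^ ε * √V ^ m :=
    one_le_mul_of_one_le_of_one_le (one_le_mul_of_one_le_of_one_le hCC
      (Real.one_le_rpow hV' hε.le)) (one_le_pow₀ (Real.one_le_sqrt.2 hV'))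
  rcases lt_or_ge m 2 with hm2 | hm2
  · -- `m = 1` is excluded by `∑ c = 0`, and there is a single empty tuple.
    refine le_trans ?_ hrhs
    have : m = 0 := by
      by_contra h
      obtain rfl : m = 1 := by omega
      exact hc 0 (by simpa using hc0)
    subst this
    exact_mod_cast Finset.card_le_one_of_subsingleton S
  rcases S.eq_empty_or_nonempty with rfl | ⟨u₀, hu₀⟩
  · simpa using zero_le_one.trans hrhs
  obtain ⟨τ, hτ1, hτ, hfin⟩ := hbd V hV
  set P₀ := recipNumerator c u₀ with hP₀
  have hx : ∀ u ∈ S, (((recipNumerator c u).eval (-lam) : ℤ) : ZMod q) = 0 := fun u hu =>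
    eval_recipNumerator_eq_zero c u lam (hS u hu).2.2.1 (hS u hu).2.2.2
  have hP : ∀ u ∈ S, recipNumerator c u ≠ 0 := fun u hu h => by
    have := eval_recipNumerator_ne_zero (hS u hu).1 (hc ⟨0, by omega⟩)
    rw [h, eval_zero] at this
    exact this rfl
  have hdeg : P₀.natDegree ≤ N := by
    have := natDegree_recipNumerator_lt (u := u₀) hc0 (by simpa using hm2)
    rw [Fintype.card_fin, ← hP₀] at this
    omega
  set H := ∑ t ∈ Finset.range (2 * V + 1), (1 : ℝ) / (t + 1) with hH
  have hH1 : 1 ≤ H := one_le_sum_one_div V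
  set R := (P₀.aroots ℂ).toFinset with hR
  have hcover : S ⊆ R.biUnion fun β => S.filter fun u => aeval β (recipNumerator c u) = 0 := by
    intro u hu
    obtain ⟨β, h1, h2⟩ := exists_common_root_recipNumerator hN hm2 hmN hV hq hc hcN hc0
      (hS u₀ hu₀).1 (hS u hu).1 (hS u₀ hu₀).2.1 (hS u hu).2.1 (hx u₀ hu₀) (hx u hu)
    rw [Finset.mem_biUnion]
    refine ⟨β, ?_, Finset.mem_filter.2 ⟨hu, h2⟩⟩
    rw [hR, Multiset.mem_toFinset, mem_aroots]
    exact ⟨hP u₀ hu₀, h1⟩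
  have hRcard : R.card ≤ N := (Multiset.toFinset_card_le _).trans
    ((card_roots' _).trans (natDegree_map_le.trans hdeg))
  have hone : ∀ β ∈ R, ((S.filter fun u => aeval β (recipNumerator c u) = 0).card : ℝ) ≤
      √V ^ m * (√(5 + 2 * N : ℝ) ^ N * (2 * (C₁ * (V : ℝ) ^ ε))) := by
    intro β hβ
    rw [hR, Multiset.mem_toFinset, mem_aroots] at hβ
    obtain ⟨f, hirr, hfP, hfβ⟩ := exists_irreducible_dvd_of_aeval_eq_zero hβ.1 hβ.2
    have hd := natDegree_ne_zero_of_aeval_eq_zero hirr hfβ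
    have hfd : f.natDegree ≤ N := (natDegree_le_of_dvd hfP hβ.1).trans hdeg
    have hfd' : (f.natDegree : ℝ) ≤ N := by exact_mod_cast hfd
    have hdvd : ∀ u ∈ S.filter (fun u => aeval β (recipNumerator c u) = 0),
        f ∣ recipNumerator c u := fun u hu =>
      dvd_of_aeval_eq_zero hirr hfβ (Finset.mem_filter.1 hu).2
    have := card_le_of_dvd_recipNumerator hmN (hirr.isPrimitive hd) hd hV (B := N) (by omega) hτ1 hc
      hcN (S.filter fun u => aeval β (recipNumerator c u) = 0)
      (fun u hu => ⟨(hS u (Finset.mem_filter.1 hu).1).1, (hS u (Finset.mem_filter.1 hu).1).2.1,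
        hdvd u hu⟩) ?_
    · refine this.trans ?_
      rw [Real.sqrt_mul (by positivity), mul_pow, mul_comm (_ ^ m) (_ ^ m), mul_assoc]
      have hbase : 1 ≤ τ ^ N * (N * (2 * H)) := one_le_mul_of_one_le_of_one_le (one_le_pow₀ hτ1)
        (one_le_mul_of_one_le_of_one_le hN' (by linarith))
      gcongr
      · calc _ ≤ (τ ^ N * (N * (2 * H))) ^ m := by gcongr
          _ ≤ (τ ^ N * (N * (2 * H))) ^ N := pow_le_pow_right₀ hbase hmN
          _ ≤ _ := hfin
    · intro u hu i
      have huS := (Finset.mem_filter.1 hu).1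
      refine hτ _ ?_
      have h1 : (f.eval (u i)).natAbs ∣ ((recipNumerator c u).eval (u i)).natAbs :=
        Int.natAbs_dvd_natAbs.2 (eval_dvd (hdvd u hu))
      have h2 := eval_recipNumerator_ne_zero (hS u huS).1 (hc i)
      refine (Nat.le_of_dvd (Int.natAbs_pos.2 h2) h1).trans ?_
      have h3 : |(recipNumerator c u).eval (u i)| ≤ N * (2 * V : ℤ) ^ N := by
        rw [eval_recipNumerator, abs_mul, Finset.abs_prod]
        calc _ ≤ (N : ℤ) * ∏ _j ∈ Finset.univ.erase i, (2 * V : ℤ) := by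
              gcongr with j hj
              · exact hcN i
              · have h4 := (hS u huS).2.1 i
                have h5 := (hS u huS).2.1 j
                have := abs_sub (u i) (u j)
                linarith
          _ ≤ _ := by
              rw [Finset.prod_const]
              gcongr
              · have : (1 : ℤ) ≤ V := by exact_mod_cast hV
                linarith
              · refine (Finset.card_le_univ _).trans ?_
                simpa using hmN
      rw [Int.abs_eq_natAbs] at h3
      exact_mod_cast h3
  calc (S.card : ℝ)
      ≤ ∑ β ∈ R, ((S.filter fun u => aeval β (recipNumerator c u) = 0).card : ℝ) := by
        exact_mod_cast (Finset.card_le_card hcover).trans Finset.card_biUnion_le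
    _ ≤ ∑ _β ∈ R, √V ^ m * (√(5 + 2 * N : ℝ) ^ N * (2 * (C₁ * (V : ℝ) ^ ε))) :=
        Finset.sum_le_sum hone
    _ ≤ N * (√V ^ m * (√(5 + 2 * N : ℝ) ^ N * (2 * (C₁ * (V : ℝ) ^ ε)))) := by
        rw [Finset.sum_const, nsmul_eq_mul]
        gcongr
    _ = _ := by ring

/-! ### Coincident entries -/

section Degenerate

variable {ι : Type*} [Fintype ι] [DecidableEq ι]

/-- The total coefficient which the index `k` receives when each index `i` is replaced by its
representative `σ i`. -/
def groupedCoeff (sgn : ι → ℤ) (σ : ι → ι) (k : ι) : ℤ := ∑ i with σ i = k, sgn i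

lemma sum_groupedCoeff_mul {R : Type*} [CommRing R] (sgn : ι → ℤ) (σ : ι → ι) (g : ι → R) :
    ∑ k, (groupedCoeff sgn σ k : R) * g k = ∑ i, (sgn i : R) * g (σ i) := by
  rw [← Finset.sum_fiberwise Finset.univ σ fun i => (sgn i : R) * g (σ i)]
  refine Finset.sum_congr rfl fun k _ => ?_
  rw [groupedCoeff, Int.cast_sum, Finset.sum_mul]
  refine Finset.sum_congr rfl fun i hi => ?_
  rw [(Finset.mem_filter.1 hi).2]

lemma abs_groupedCoeff_le {sgn : ι → ℤ} (hsgn : ∀ i, |sgn i| = 1) (σ : ι → ι) (k : ι) :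
    |groupedCoeff sgn σ k| ≤ Fintype.card ι := by
  refine (Finset.abs_sum_le_sum_abs _ _).trans ?_
  simp only [hsgn, Finset.sum_const, nsmul_eq_mul, mul_one]
  exact_mod_cast Finset.card_le_univ _

/-- A class of indices whose signs cancel has at least two elements. -/
lemma two_mul_card_add_card_le {sgn : ι → ℤ} (hsgn : ∀ i, |sgn i| = 1) (σ : ι → ι) :
    2 * (Finset.univ.filter fun k => σ k = k ∧ groupedCoeff sgn σ k = 0).card +
      (Finset.univ.filter fun k => groupedCoeff sgn σ k ≠ 0).card ≤ Fintype.card ι := by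
  set K₀ := Finset.univ.filter fun k => σ k = k ∧ groupedCoeff sgn σ k = 0
  set K₁ := Finset.univ.filter fun k => groupedCoeff sgn σ k ≠ 0
  have hdisj : Disjoint K₀ K₁ := by
    rw [Finset.disjoint_left]
    intro k h0 h1
    exact (Finset.mem_filter.1 h1).2 (Finset.mem_filter.1 h0).2.2
  have h0 : ∀ k ∈ K₀, 2 ≤ (Finset.univ.filter fun i => σ i = k).card := by
    intro k hk
    obtain ⟨hσ, hc⟩ := (Finset.mem_filter.1 hk).2
    have hmem : k ∈ Finset.univ.filter fun i => σ i = k := by simp [hσ]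
    by_contra! hlt
    have h1 : Finset.univ.filter (fun i => σ i = k) = {k} :=
      Finset.eq_singleton_iff_unique_mem.2 ⟨hmem, fun x hx =>
        Finset.card_le_one.1 (by omega) x hx k hmem⟩
    rw [groupedCoeff, h1, Finset.sum_singleton] at hc
    have := hsgn k
    rw [hc] at this
    simp at this
  have h1 : ∀ k ∈ K₁, 1 ≤ (Finset.univ.filter fun i => σ i = k).card := by
    intro k hk
    have hc := (Finset.mem_filter.1 hk).2
    rw [Nat.one_le_iff_ne_zero, Ne, Finset.card_eq_zero]
    intro he
    exact hc (by rw [groupedCoeff, he, Finset.sum_empty])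
  calc 2 * K₀.card + K₁.card = ∑ _k ∈ K₀, 2 + ∑ _k ∈ K₁, 1 := by simp [mul_comm]
    _ ≤ ∑ k ∈ K₀, (Finset.univ.filter fun i => σ i = k).card +
        ∑ k ∈ K₁, (Finset.univ.filter fun i => σ i = k).card :=
      add_le_add (Finset.sum_le_sum h0) (Finset.sum_le_sum h1)
    _ = ∑ k ∈ K₀ ∪ K₁, (Finset.univ.filter fun i => σ i = k).card :=
      (Finset.sum_union hdisj).symm
    _ ≤ ∑ k, (Finset.univ.filter fun i => σ i = k).card :=
      Finset.sum_le_sum_of_subset (Finset.subset_univ _)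
    _ = Fintype.card ι := (Finset.card_eq_sum_card_fiberwise (by simp)).symm

/-- Solutions with a prescribed pattern of coincidences: equal entries are grouped, a group whose
coefficient cancels is free, and the others form an injective solution. -/
lemma card_solutions_le_of_pattern {sgn : ι → ℤ} (hsgn : ∀ i, |sgn i| = 1) (hsum : ∑ i, sgn i = 0)
    (σ : ι → ι) {q V : ℕ} {lam : ℤ} (hV : 1 ≤ V) (S : Finset (ι → ℤ)) {B : ℝ} (hB : 1 ≤ B)
    (hcore : ∀ (m : ℕ) (c : Fin m → ℤ) (T : Finset (Fin m → ℤ)), m ≤ Fintype.card ι →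
      (∀ i, c i ≠ 0) → (∀ i, |c i| ≤ Fintype.card ι) → ∑ i, c i = 0 →
      (∀ u ∈ T, Function.Injective u ∧ (∀ i, |u i| ≤ V) ∧
        (∀ i, IsUnit ((lam + u i : ℤ) : ZMod q)) ∧
        ∑ i, (c i : ZMod q) * ((lam + u i : ℤ) : ZMod q)⁻¹ = 0) → (T.card : ℝ) ≤ B * √V ^ m)
    (hS : ∀ z ∈ S, (∀ i, |z i| ≤ V) ∧ (∀ i, IsUnit ((lam + z i : ℤ) : ZMod q)) ∧
      ∑ i, (sgn i : ZMod q) * ((lam + z i : ℤ) : ZMod q)⁻¹ = 0)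
    (hσ : ∀ z ∈ S, (∀ i, z (σ i) = z i) ∧ ∀ i j, z i = z j → σ i = σ j) :
    (S.card : ℝ) ≤ 3 ^ Fintype.card ι * (B * √V ^ Fintype.card ι) := by
  have hV' : (1 : ℝ) ≤ V := by exact_mod_cast hV
  have hsV : 1 ≤ √(V : ℝ) := Real.one_le_sqrt.2 hV'
  rcases S.eq_empty_or_nonempty with rfl | ⟨z₀, hz₀⟩
  · simp only [Finset.card_empty, Nat.cast_zero]; positivity
  have hidem : ∀ i, σ (σ i) = σ i := fun i => (hσ z₀ hz₀).2 _ _ ((hσ z₀ hz₀).1 i)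
  set c := groupedCoeff sgn σ with hc
  set K₀ := Finset.univ.filter fun k => σ k = k ∧ c k = 0 with hK₀
  set K₁ := Finset.univ.filter fun k => c k ≠ 0 with hK₁
  have hfix : ∀ k ∈ K₁, σ k = k := by
    intro k hk
    obtain ⟨i, hi⟩ : (Finset.univ.filter fun i => σ i = k).Nonempty := by
      rw [Finset.nonempty_iff_ne_empty]
      intro he
      exact (Finset.mem_filter.1 hk).2 (by rw [hc, groupedCoeff, he, Finset.sum_empty])
    rw [← (Finset.mem_filter.1 hi).2, hidem]
  have hcard := two_mul_card_add_card_le hsgn σ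
  set e : Fin K₁.card ≃ K₁ := K₁.equivFin.symm
  have hsumK : ∀ {R : Type} [CommRing R] (g : ι → R),
      ∑ i, (c (e i) : R) * g (e i) = ∑ k, (c k : R) * g k := by
    intro R _ g
    rw [Equiv.sum_comp e (fun k : K₁ => (c k : R) * g k),
      Finset.sum_coe_sort K₁ (fun k => (c k : R) * g k)]
    refine Finset.sum_subset (Finset.subset_univ _) fun k _ hk => ?_
    have : c k = 0 := by simpa [hK₁] using hk
    rw [this, Int.cast_zero, zero_mul]
  set T := S.image fun z (i : Fin K₁.card) => z (e i) with hT
  have hTcard : (T.card : ℝ) ≤ B * √V ^ K₁.card := by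
    refine hcore _ (fun i => c (e i)) T (Finset.card_le_univ _)
      (fun i => (Finset.mem_filter.1 (e i).2).2) (fun i => abs_groupedCoeff_le hsgn σ _) ?_ ?_
    · have h1 := hsumK (R := ℤ) fun _ => 1
      have h2 := sum_groupedCoeff_mul (R := ℤ) sgn σ fun _ => 1
      simp only [mul_one, Int.cast_id] at h1 h2
      rw [h1, h2, hsum]
    · intro u hu
      obtain ⟨z, hz, rfl⟩ := Finset.mem_image.1 hu
      refine ⟨fun i j hij => ?_, fun i => (hS z hz).1 _, fun i => (hS z hz).2.1 _, ?_⟩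
      · have h1 := (hσ z hz).2 _ _ hij
        rw [hfix _ (e i).2, hfix _ (e j).2] at h1
        exact e.injective (Subtype.ext h1)
      · have h1 := hsumK (R := ZMod q) fun k => ((lam + z k : ℤ) : ZMod q)⁻¹
        refine h1.trans ?_
        rw [hc, sum_groupedCoeff_mul]
        simp only [(hσ z hz).1]
        exact (hS z hz).2.2
  have hmain : S.card ≤
      ((Fintype.piFinset fun _ : K₀ => Finset.Icc (-(V : ℤ)) V) ×ˢ T).card := by
    refine Finset.card_le_card_of_injOn (fun z => (fun k : K₀ => z k, fun i => z (e i))) ?_ ?_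
    · intro z hz
      have hz' : z ∈ S := hz
      simp only [Finset.coe_product, Set.mem_prod, Finset.mem_coe, Fintype.mem_piFinset,
        Finset.mem_Icc]
      exact ⟨fun k => abs_le.1 ((hS z hz').1 _), Finset.mem_image_of_mem _ hz'⟩
    · intro z hz z' hz' h
      have hz1 : z ∈ S := hz
      have hz1' : z' ∈ S := hz'
      simp only [Prod.mk.injEq] at h
      have hrep : ∀ k, σ k = k → z k = z' k := by
        intro k hk
        by_cases hck : c k = 0
        · exact congrFun h.1 ⟨k, by simp [hK₀, hk, hck]⟩
        · have h1 := congrFun h.2 (e.symm ⟨k, by simp [hK₁, hck]⟩)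
          simpa using h1
      ext i
      rw [← (hσ z hz1).1, ← (hσ z' hz1').1, hrep _ (hidem i)]
  rw [Finset.card_product, Fintype.card_piFinset, Finset.prod_const, Int.card_Icc, Finset.card_univ,
    Fintype.card_coe] at hmain
  have e1 : ((V : ℤ) + 1 - -(V : ℤ)).toNat = 2 * V + 1 := by omega
  rw [e1] at hmain
  calc (S.card : ℝ) ≤ (2 * V + 1) ^ K₀.card * T.card := by exact_mod_cast hmain
    _ ≤ (3 * √(V : ℝ) ^ 2) ^ K₀.card * (B * √V ^ K₁.card) := by
        rw [Real.sq_sqrt (by positivity)]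
        gcongr
        linarith
    _ = 3 ^ K₀.card * (B * √V ^ (2 * K₀.card + K₁.card)) := by rw [mul_pow, pow_add, pow_mul]; ring
    _ ≤ _ := by
        gcongr
        · norm_num
        · exact Finset.card_le_univ _

lemma card_solutions_le (sgn : ι → ℤ) (hsgn : ∀ i, |sgn i| = 1) (hsum : ∑ i, sgn i = 0)
    (hN : 4 ≤ Fintype.card ι) (ε : ℝ) (hε : 0 < ε) :
    ∃ C : ℝ, 1 ≤ C ∧ ∀ (q V : ℕ) (lam : ℤ) (S : Finset (ι → ℤ)), 1 ≤ V →
      resultantConst (Fintype.card ι) * V ^ (Fintype.card ι * (Fintype.card ι - 2)) < q →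
      (∀ z ∈ S, (∀ i, |z i| ≤ V) ∧ (∀ i, IsUnit ((lam + z i : ℤ) : ZMod q)) ∧
        ∑ i, (sgn i : ZMod q) * ((lam + z i : ℤ) : ZMod q)⁻¹ = 0) →
      (S.card : ℝ) ≤ C * (V : ℝ) ^ ε * √V ^ Fintype.card ι := by
  classical
  obtain ⟨C, hC, hcore⟩ := card_injective_solutions_le (Fintype.card ι) hN ε hε
  have hpos : 1 ≤ (Fintype.card (ι → ι) : ℝ) := by
    exact_mod_cast Fintype.card_pos_iff.2 ⟨id⟩
  refine ⟨Fintype.card (ι → ι) * (3 ^ Fintype.card ι * C),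
    one_le_mul_of_one_le_of_one_le hpos (one_le_mul_of_one_le_of_one_le
      (one_le_pow₀ (by norm_num)) hC), fun q V lam S hV hq hS => ?_⟩
  have hV' : (1 : ℝ) ≤ V := by exact_mod_cast hV
  have : Nonempty ι := Fintype.card_pos_iff.1 (by omega)
  set pat : (ι → ι) → Finset (ι → ℤ) := fun σ =>
    S.filter fun z => (∀ i, z (σ i) = z i) ∧ ∀ i j, z i = z j → σ i = σ j with hpat
  have hcover : S ⊆ Finset.univ.biUnion pat := by
    intro z hz
    rw [Finset.mem_biUnion]
    have hex : ∀ i, ∃ j, z j = z i := fun i => ⟨i, rfl⟩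
    exact ⟨fun i => Function.invFun z (z i), Finset.mem_univ _, Finset.mem_filter.2
      ⟨hz, fun i => Function.invFun_eq (hex i), fun i j hij => congrArg (Function.invFun z) hij⟩⟩
  have hone : ∀ σ ∈ (Finset.univ : Finset (ι → ι)), ((pat σ).card : ℝ) ≤
      3 ^ Fintype.card ι * (C * (V : ℝ) ^ ε * √V ^ Fintype.card ι) := fun σ _ =>
    card_solutions_le_of_pattern hsgn hsum σ hV (pat σ)
      (one_le_mul_of_one_le_of_one_le hC (Real.one_le_rpow hV' hε.le))
      (fun m c T hm h1 h2 h3 h4 => hcore m q V lam c T hm hV hq h1 h2 h3 h4)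
      (fun z hz => hS z (Finset.mem_filter.1 hz).1) fun z hz => (Finset.mem_filter.1 hz).2
  calc (S.card : ℝ) ≤ ∑ σ, ((pat σ).card : ℝ) := by
        exact_mod_cast (Finset.card_le_card hcover).trans Finset.card_biUnion_le
    _ ≤ ∑ _σ : ι → ι, 3 ^ Fintype.card ι * (C * (V : ℝ) ^ ε * √V ^ Fintype.card ι) :=
        Finset.sum_le_sum hone
    _ = _ := by rw [Finset.sum_const, nsmul_eq_mul, Finset.card_univ]; ring

end Degenerate

lemma isUnit_intCast_zmod_of_gcd_eq_one {q : ℕ} {a : ℤ} (h : Int.gcd a q = 1) :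
    IsUnit (a : ZMod q) := by
  obtain ⟨x, y, hxy⟩ := Int.isCoprime_iff_gcd_eq_one.2 h
  have := congrArg (fun n : ℤ => (n : ZMod q)) hxy
  push_cast at this
  rw [ZMod.natCast_self, mul_zero, add_zero, mul_comm] at this
  exact IsUnit.of_mul_eq_one _ this

lemma kloostermanCount_le_of_short (r : ℕ) (hr : 2 ≤ r) (ε : ℝ) (hε : 0 < ε) :
    ∃ C : ℝ, 1 ≤ C ∧ ∀ (q V : ℕ) (lam : ℤ), 1 ≤ V →
      resultantConst (2 * r) * V ^ (2 * r * (2 * r - 2)) < q →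
      (kloostermanCount r q lam V : ℝ) ≤ C * (V : ℝ) ^ ε * (V : ℝ) ^ r := by
  set sgn : Fin r ⊕ Fin r → ℤ := Sum.elim (fun _ => 1) (fun _ => -1) with hsgn
  have hcard : Fintype.card (Fin r ⊕ Fin r) = 2 * r := by simp [two_mul]
  obtain ⟨C, hC, h⟩ := card_solutions_le sgn (by rintro (i | i) <;> simp [hsgn]) (by simp [hsgn])
    (by omega) ε hε
  refine ⟨C, hC, fun q V lam hV hq => ?_⟩
  rw [hcard] at h
  rw [kloostermanCount, ← Finset.card_image_of_injective _
    (f := fun p : (Fin r → ℤ) × (Fin r → ℤ) => Sum.elim p.1 p.2) ?_]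
  · refine (h q V lam _ hV hq ?_).trans (le_of_eq ?_)
    · intro z hz
      obtain ⟨⟨v, w⟩, hp, rfl⟩ := Finset.mem_image.1 hz
      simp only [Finset.mem_filter, Finset.mem_product, Fintype.mem_piFinset, Finset.mem_Icc,
        ← abs_le] at hp
      obtain ⟨⟨hv, hw⟩, hv1, hw1, heq⟩ := hp
      refine ⟨?_, ?_, ?_⟩
      · rintro (i | i)
        exacts [hv i, hw i]
      · rintro (i | i)
        exacts [isUnit_intCast_zmod_of_gcd_eq_one (hv1 i),
          isUnit_intCast_zmod_of_gcd_eq_one (hw1 i)]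
      · rw [Fintype.sum_sum_type]
        simp only [hsgn, Sum.elim_inl, Sum.elim_inr, Int.cast_one, Int.cast_neg, one_mul,
          neg_one_mul, Finset.sum_neg_distrib]
        rw [heq, add_neg_cancel]
    · rw [pow_mul, Real.sq_sqrt (by positivity)]
  · rintro ⟨v, w⟩ ⟨v', w'⟩ hp
    ext i
    · exact congrFun hp (Sum.inl i)
    · exact congrFun hp (Sum.inr i)

/-! ### Cutting an interval into blocks -/

section Energy

variable {α : Type*} {q : ℕ} [NeZero q]

/-- The number of pairs of `r`-tuples from `A` with the same sum of values of `x`. -/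
def tupleEnergy (r : ℕ) (x : α → ZMod q) (A : Finset α) : ℕ :=
  (((Fintype.piFinset fun _ : Fin r => A) ×ˢ (Fintype.piFinset fun _ : Fin r => A)).filter
    fun p : (Fin r → α) × (Fin r → α) => ∑ i, x (p.1 i) = ∑ i, x (p.2 i)).card

/-- Orthogonality of the additive characters modulo `q`. -/
lemma mul_tupleEnergy_eq (r : ℕ) (x : α → ZMod q) (A : Finset α) :
    (q : ℝ) * tupleEnergy r x A =
      ∑ h : ZMod q, ‖∑ a ∈ A, ZMod.stdAddChar (h * x a)‖ ^ (2 * r) := by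
  have hpow : ∀ h : ZMod q, (∑ a ∈ A, ZMod.stdAddChar (h * x a)) ^ r =
      ∑ v ∈ Fintype.piFinset fun _ : Fin r => A, ZMod.stdAddChar (h * ∑ i, x (v i)) := by
    intro h
    calc _ = ∏ _i : Fin r, ∑ a ∈ A, ZMod.stdAddChar (h * x a) := by simp
      _ = _ := by
        rw [Finset.prod_univ_sum]
        refine Finset.sum_congr rfl fun v _ => ?_
        rw [Finset.mul_sum]
        exact (map_prod (ZMod.stdAddChar (N := q)).toMonoidHom
          (fun i => Multiplicative.ofAdd (h * x (v i))) Finset.univ).symm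
  have hnorm : ∀ h : ZMod q, ((‖∑ a ∈ A, ZMod.stdAddChar (h * x a)‖ ^ (2 * r) : ℝ) : ℂ) =
      ∑ p ∈ (Fintype.piFinset fun _ : Fin r => A) ×ˢ (Fintype.piFinset fun _ : Fin r => A),
        ZMod.stdAddChar (h * (∑ i, x (p.1 i) - ∑ i, x (p.2 i))) := by
    intro h
    rw [pow_mul, Complex.ofReal_pow, Complex.ofReal_pow, ← Complex.mul_conj', mul_pow,
      ← map_pow, hpow, map_sum, Finset.sum_mul_sum, ← Finset.sum_product']
    refine Finset.sum_congr rfl fun p _ => ?_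
    rw [← AddChar.map_neg_eq_conj, ← AddChar.map_add_eq_mul]
    congr 1
    ring
  have key : ((q : ℝ) * tupleEnergy r x A : ℂ) =
      ((∑ h : ZMod q, ‖∑ a ∈ A, ZMod.stdAddChar (h * x a)‖ ^ (2 * r) : ℝ) : ℂ) := by
    rw [Complex.ofReal_sum, Finset.sum_congr rfl fun h _ => hnorm h, Finset.sum_comm,
      Finset.sum_congr rfl fun p _ => AddChar.sum_mulShift _ (ZMod.isPrimitive_stdAddChar q),
      tupleEnergy, Finset.card_filter]
    push_cast
    rw [Finset.mul_sum]
    refine Finset.sum_congr rfl fun p _ => ?_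
    simp only [sub_eq_zero, ZMod.card]
    split_ifs <;> simp
  exact_mod_cast key

/-- Hölder's inequality for the energies of the parts of a partition. -/
lemma tupleEnergy_le_of_partition {β : Type*} [DecidableEq β] {r : ℕ} (hr : 1 ≤ r)
    (x : α → ZMod q) (A : Finset α) (J : Finset β) (g : α → β) (hg : ∀ a ∈ A, g a ∈ J) {E : ℝ}
    (hE : ∀ j ∈ J, (tupleEnergy r x (A.filter fun a => g a = j) : ℝ) ≤ E) :
    (tupleEnergy r x A : ℝ) ≤ (J.card : ℝ) ^ (2 * r) * E := by
  have hq : (0 : ℝ) < q := by exact_mod_cast NeZero.pos q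
  refine le_of_mul_le_mul_left ?_ hq
  obtain ⟨n, hn⟩ : ∃ n, 2 * r = n + 1 := ⟨2 * r - 1, by omega⟩
  rw [mul_tupleEnergy_eq]
  calc _ ≤ ∑ h : ZMod q, (J.card : ℝ) ^ n * ∑ j ∈ J,
        ‖∑ a ∈ A with g a = j, ZMod.stdAddChar (h * x a)‖ ^ (2 * r) := by
        refine Finset.sum_le_sum fun h _ => ?_
        rw [← Finset.sum_fiberwise_of_maps_to hg, hn]
        refine le_trans ?_ (pow_sum_le_card_mul_sum_pow (fun _ _ => norm_nonneg _) n)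
        gcongr
        exact norm_sum_le _ _
    _ = (J.card : ℝ) ^ n * ∑ j ∈ J, (q : ℝ) * tupleEnergy r x (A.filter fun a => g a = j) := by
        rw [← Finset.mul_sum, Finset.sum_comm]
        simp only [mul_tupleEnergy_eq]
    _ ≤ (J.card : ℝ) ^ n * ∑ _j ∈ J, (q : ℝ) * E := by
        gcongr with j hj
        exact hE j hj
    _ = _ := by rw [Finset.sum_const, nsmul_eq_mul, hn]; ring

end Energy

section Blocks

variable {r q : ℕ} [NeZero q] {lam : ℤ}

/-- The integers `v` with `|v| ≤ V` and `lam + v` prime to `q`. -/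
noncomputable def coprimeInterval (q : ℕ) (lam : ℤ) (V : ℕ) : Finset ℤ :=
  (Finset.Icc (-(V : ℤ)) V).filter fun v => Int.gcd (lam + v) q = 1

lemma kloostermanCount_eq_tupleEnergy (r q : ℕ) [NeZero q] (lam : ℤ) (V : ℕ) :
    kloostermanCount r q lam V =
      tupleEnergy r (fun v : ℤ => ((lam + v : ℤ) : ZMod q)⁻¹) (coprimeInterval q lam V) := by
  rw [kloostermanCount, tupleEnergy]
  congr 1
  ext p
  simp only [Finset.mem_filter, Finset.mem_product, Fintype.mem_piFinset, coprimeInterval,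
    forall_and]
  tauto

/-- A block of length `V₀` is contained in a translate of `[-V₀, V₀]`. -/
lemma tupleEnergy_block_le (V : ℕ) {V₀ : ℕ} (hV₀ : 1 ≤ V₀) (j : ℤ) :
    tupleEnergy r (fun v : ℤ => ((lam + v : ℤ) : ZMod q)⁻¹)
      ((coprimeInterval q lam V).filter fun v => v / (V₀ : ℤ) = j) ≤
      kloostermanCount r q (lam + j * V₀) V₀ := by
  have hmem : ∀ v, v ∈ (coprimeInterval q lam V).filter (fun v => v / (V₀ : ℤ) = j) →
      v - j * V₀ ∈ coprimeInterval q (lam + j * V₀) V₀ := by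
    intro v hv
    simp only [coprimeInterval, Finset.mem_filter, Finset.mem_Icc] at hv ⊢
    obtain ⟨⟨-, hgcd⟩, rfl⟩ := hv
    have hpos : (0 : ℤ) < V₀ := by exact_mod_cast hV₀
    have h1 := Int.emod_nonneg v hpos.ne'
    have h2 := Int.emod_lt_of_pos v hpos
    have h3 := Int.emod_add_mul_ediv v V₀
    refine ⟨⟨by linarith, by linarith⟩, ?_⟩
    rwa [add_add_sub_cancel]
  rw [kloostermanCount_eq_tupleEnergy, tupleEnergy, tupleEnergy]
  refine Finset.card_le_card_of_injOn
    (fun p => (fun i => p.1 i - j * V₀, fun i => p.2 i - j * V₀)) ?_ ?_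
  · rintro ⟨v, w⟩ hp
    simp only [Finset.coe_filter, Finset.mem_product, Fintype.mem_piFinset,
      Set.mem_ofPred_eq] at hp ⊢
    refine ⟨⟨fun i => hmem _ (hp.1.1 i), fun i => hmem _ (hp.1.2 i)⟩, ?_⟩
    simpa only [add_add_sub_cancel] using hp.2
  · rintro ⟨v, w⟩ _ ⟨v', w'⟩ _ h
    simp only [Prod.mk.injEq] at h
    ext i
    · simpa using congrFun h.1 i
    · simpa using congrFun h.2 i

lemma kloostermanCount_mul_pow_le (hr : 1 ≤ r) (lam : ℤ) {V V₀ : ℕ} (hV₀ : 1 ≤ V₀) (hV : V₀ ≤ V)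
    {E : ℝ} (hE : ∀ lam', (kloostermanCount r q lam' V₀ : ℝ) ≤ E) :
    (kloostermanCount r q lam V : ℝ) * (V₀ : ℝ) ^ (2 * r) ≤ (4 * V : ℝ) ^ (2 * r) * E := by
  have hE0 : 0 ≤ E := (Nat.cast_nonneg _).trans (hE 0)
  set J := Finset.Icc (-(V : ℤ) / V₀) ((V : ℤ) / V₀) with hJ
  have hpos : (0 : ℤ) < V₀ := by exact_mod_cast hV₀
  have h := tupleEnergy_le_of_partition hr (fun v : ℤ => ((lam + v : ℤ) : ZMod q)⁻¹)
    (coprimeInterval q lam V) J (fun v => v / (V₀ : ℤ)) (fun v hv => by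
      simp only [coprimeInterval, Finset.mem_filter, Finset.mem_Icc] at hv
      rw [hJ, Finset.mem_Icc]
      exact ⟨Int.ediv_le_ediv hpos hv.1.1, Int.ediv_le_ediv hpos hv.1.2⟩)
    (fun j _ => (Nat.cast_le.2 (tupleEnergy_block_le V hV₀ j)).trans (hE _))
  rw [← kloostermanCount_eq_tupleEnergy] at h
  have hJcard : (J.card : ℝ) * V₀ ≤ 4 * V := by
    have h1 : (J.card : ℤ) ≤ 2 * ((V : ℤ) / V₀) + 2 := by
      have h2 : -((V : ℤ) / V₀) - 1 ≤ -(V : ℤ) / V₀ := by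
        rw [Int.le_ediv_iff_mul_le hpos]
        have h3 := Int.emod_lt_of_pos (V : ℤ) hpos
        have h4 := Int.emod_add_mul_ediv (V : ℤ) V₀
        nlinarith
      have h5 : 0 ≤ (V : ℤ) / V₀ := Int.ediv_nonneg (by positivity) hpos.le
      rw [hJ, Int.card_Icc]
      omega
    have h6 : (V : ℤ) / V₀ * V₀ ≤ V := Int.ediv_mul_le _ hpos.ne'
    have h7 : (V₀ : ℤ) ≤ V := by exact_mod_cast hV
    have h8 : (J.card : ℤ) * V₀ ≤ 4 * V := by nlinarith
    exact_mod_cast h8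
  calc _ ≤ (J.card : ℝ) ^ (2 * r) * E * (V₀ : ℝ) ^ (2 * r) := by gcongr
    _ = (J.card * V₀ : ℝ) ^ (2 * r) * E := by rw [mul_pow]; ring
    _ ≤ _ := by gcongr

end Blocks

lemma kloostermanCount_le_trivial (r q : ℕ) (lam : ℤ) (V : ℕ) :
    kloostermanCount r q lam V ≤ (2 * V + 1) ^ (2 * r) := by
  rw [kloostermanCount]
  refine (Finset.card_filter_le _ _).trans (le_of_eq ?_)
  rw [Finset.card_product, Fintype.card_piFinset, Finset.prod_const, Int.card_Icc]
  have : ((V : ℤ) + 1 - -(V : ℤ)).toNat = 2 * V + 1 := by omega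
  rw [this, Finset.card_univ, Fintype.card_fin, ← pow_add, ← two_mul]

lemma one_le_resultantConst {N : ℕ} (hN : 1 ≤ N) : 1 ≤ resultantConst N :=
  Nat.one_le_iff_ne_zero.2 (mul_ne_zero (Nat.factorial_ne_zero _)
    (pow_ne_zero _ (mul_ne_zero (by omega) (mul_ne_zero (by omega) (by positivity)))))

/-! ### The bound for all lengths -/

theorem corollary14 (r : ℕ) (hr : 2 ≤ r) (ε : ℝ) (hε : 0 < ε) :
    ∃ C : ℝ, 0 < C ∧ ∀ (q V : ℕ) (lam : ℤ), 1 ≤ q → 1 ≤ V →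
      (kloostermanCount r q lam V : ℝ) ≤
        C * ((V : ℝ) ^ (2 * r) / (q : ℝ) ^ ((1 : ℝ) / (4 * ((r : ℝ) - 1))) + (V : ℝ) ^ r)
          * (q : ℝ) ^ ε := by
  obtain ⟨C, hC, hshort⟩ := kloostermanCount_le_of_short r hr ε hε
  set c₀ := resultantConst (2 * r) with hc₀
  set e := 2 * r * (2 * r - 2) with he
  set α : ℝ := (1 : ℝ) / (4 * ((r : ℝ) - 1)) with hα
  have hr' : (2 : ℝ) ≤ r := by exact_mod_cast hr
  have hc₀1 : 1 ≤ c₀ := one_le_resultantConst (by omega)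
  have hc₀' : (1 : ℝ) ≤ c₀ := by exact_mod_cast hc₀1
  have he0 : e ≠ 0 := mul_ne_zero (by omega) (by omega)
  have hα0 : 0 ≤ α := by rw [hα]; apply div_nonneg <;> linarith
  have hα1 : α ≤ 1 := by rw [hα, div_le_one (by linarith)]; linarith
  -- This identity is where the exponent `1 / (4(r - 1))` comes from: `V₀ ^ r` is about `q ^ α`.
  have heα : (e : ℝ) * α = r := by
    rw [he, hα, Nat.cast_mul, Nat.cast_sub (by omega)]
    push_cast
    have : (r : ℝ) - 1 ≠ 0 := by linarith
    field_simp
    ring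
  have hc₀α : (c₀ : ℝ) ^ α ≤ c₀ := by
    calc (c₀ : ℝ) ^ α ≤ (c₀ : ℝ) ^ (1 : ℝ) := Real.rpow_le_rpow_of_exponent_le hc₀' hα1
      _ = c₀ := Real.rpow_one _
  refine ⟨16 ^ r * C * c₀ * 2 ^ r, by positivity, fun q V lam hq hV => ?_⟩
  have : NeZero q := ⟨by omega⟩
  have hq' : (1 : ℝ) ≤ q := by exact_mod_cast hq
  have hV' : (1 : ℝ) ≤ V := by exact_mod_cast hV
  have hqε : 1 ≤ (q : ℝ) ^ ε := Real.one_le_rpow hq' hε.le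
  have hqα : 0 < (q : ℝ) ^ α := by positivity
  have h16 : (1 : ℝ) ≤ 16 ^ r := one_le_pow₀ (by norm_num)
  have h2r : (1 : ℝ) ≤ 2 ^ r := one_le_pow₀ (by norm_num)
  have hleq : ∀ W : ℕ, c₀ * W ^ e < q → (W : ℝ) ^ ε ≤ (q : ℝ) ^ ε := by
    intro W hW
    refine Real.rpow_le_rpow (by positivity) ?_ hε.le
    have h1 : W ≤ W ^ e := Nat.le_self_pow he0 W
    have h2 : W ^ e ≤ c₀ * W ^ e := Nat.le_mul_of_pos_left _ hc₀1
    exact_mod_cast (h1.trans h2).trans hW.le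
  rcases lt_or_ge (c₀ * V ^ e) q with hshortV | hlong
  · -- the interval is short enough for the sharp bound
    refine (hshort q V lam hV hshortV).trans ?_
    have h1 : 0 ≤ (V : ℝ) ^ (2 * r) / (q : ℝ) ^ α := by positivity
    calc C * (V : ℝ) ^ ε * (V : ℝ) ^ r ≤ C * (q : ℝ) ^ ε * (V : ℝ) ^ r := by
          gcongr C * ?_ * _
          exact hleq V hshortV
      _ = C * (V : ℝ) ^ r * (q : ℝ) ^ ε := by ring
      _ ≤ (16 ^ r * C * c₀ * 2 ^ r) * ((V : ℝ) ^ (2 * r) / (q : ℝ) ^ α + (V : ℝ) ^ r)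
          * (q : ℝ) ^ ε := by
        gcongr
        · calc C = 1 * C * 1 * 1 := by ring
            _ ≤ _ := by gcongr
        · linarith
  suffices h : (kloostermanCount r q lam V : ℝ) * (q : ℝ) ^ α ≤
      (16 ^ r * C * c₀ * 2 ^ r) * (V : ℝ) ^ (2 * r) * (q : ℝ) ^ ε by
    rw [← le_div_iff₀ hqα] at h
    refine h.trans ?_
    calc _ = (16 ^ r * C * c₀ * 2 ^ r) * ((V : ℝ) ^ (2 * r) / (q : ℝ) ^ α) * (q : ℝ) ^ ε := by ring
      _ ≤ _ := by
        gcongr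
        exact le_add_of_nonneg_right (by positivity)
  rcases le_or_gt q c₀ with hsmall | hbig
  · -- bounded moduli
    have h1 : (kloostermanCount r q lam V : ℝ) ≤ 16 ^ r * (V : ℝ) ^ (2 * r) := by
      calc (kloostermanCount r q lam V : ℝ) ≤ (2 * V + 1 : ℝ) ^ (2 * r) := by
            exact_mod_cast kloostermanCount_le_trivial r q lam V
        _ ≤ (4 * V : ℝ) ^ (2 * r) := by gcongr; linarith
        _ = _ := by rw [mul_pow, pow_mul]; norm_num
    have h2 : (q : ℝ) ^ α ≤ c₀ :=
      (Real.rpow_le_rpow (by positivity) (by exact_mod_cast hsmall) hα0).trans hc₀α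
    calc _ ≤ 16 ^ r * (V : ℝ) ^ (2 * r) * c₀ := by gcongr
      _ = (16 ^ r * 1 * c₀ * 1) * (V : ℝ) ^ (2 * r) * 1 := by ring
      _ ≤ _ := by gcongr
  -- the longest length to which the sharp bound applies
  set V₀ := Nat.findGreatest (fun n => c₀ * n ^ e < q) V with hV₀def
  have hV₀1 : 1 ≤ V₀ := Nat.le_findGreatest hV (by simpa using hbig)
  have hV₀V : V₀ ≤ V := Nat.findGreatest_le V
  have hV₀q : c₀ * V₀ ^ e < q :=
    Nat.findGreatest_spec (P := fun n => c₀ * n ^ e < q) hV (by simpa using hbig)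
  have hV₀lt : V₀ < V := by
    refine lt_of_le_of_ne hV₀V fun h => ?_
    rw [h] at hV₀q
    omega
  have hnext : q ≤ c₀ * (V₀ + 1) ^ e := not_lt.1
    (Nat.findGreatest_is_greatest (P := fun n => c₀ * n ^ e < q) (Nat.lt_succ_self _) hV₀lt)
  have hV₀' : (1 : ℝ) ≤ V₀ := by exact_mod_cast hV₀1
  have hqV₀ : (q : ℝ) ^ α ≤ c₀ * 2 ^ r * (V₀ : ℝ) ^ r := by
    have h1 : (q : ℝ) ≤ c₀ * (2 * V₀ : ℝ) ^ e := by
      calc (q : ℝ) ≤ c₀ * (V₀ + 1 : ℝ) ^ e := by exact_mod_cast hnext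
        _ ≤ _ := by gcongr; linarith
    calc (q : ℝ) ^ α ≤ (c₀ * (2 * V₀ : ℝ) ^ e) ^ α := Real.rpow_le_rpow (by positivity) h1 hα0
      _ = (c₀ : ℝ) ^ α * (2 * V₀ : ℝ) ^ r := by
        rw [Real.mul_rpow (by positivity) (by positivity), ← Real.rpow_natCast_mul (by positivity),
          heα, Real.rpow_natCast]
      _ ≤ c₀ * (2 * V₀ : ℝ) ^ r := by gcongr
      _ = _ := by rw [mul_pow]; ring
  have hblocks := kloostermanCount_mul_pow_le (r := r) (q := q) (by omega) lam hV₀1 hV₀V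
    (E := C * (q : ℝ) ^ ε * (V₀ : ℝ) ^ r) fun lam' =>
      (hshort q V₀ lam' hV₀1 hV₀q).trans (by gcongr C * ?_ * _; exact hleq V₀ hV₀q)
  have hcancel : (kloostermanCount r q lam V : ℝ) * (V₀ : ℝ) ^ r ≤
      (4 * V : ℝ) ^ (2 * r) * (C * (q : ℝ) ^ ε) := by
    refine le_of_mul_le_mul_right ?_ (by positivity : (0 : ℝ) < (V₀ : ℝ) ^ r)
    calc _ = (kloostermanCount r q lam V : ℝ) * (V₀ : ℝ) ^ (2 * r) := by
          rw [two_mul, pow_add]; ring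
      _ ≤ _ := hblocks
      _ = _ := by ring
  calc _ ≤ (kloostermanCount r q lam V : ℝ) * (c₀ * 2 ^ r * (V₀ : ℝ) ^ r) := by gcongr
    _ = c₀ * 2 ^ r * ((kloostermanCount r q lam V : ℝ) * (V₀ : ℝ) ^ r) := by ring
    _ ≤ c₀ * 2 ^ r * ((4 * V : ℝ) ^ (2 * r) * (C * (q : ℝ) ^ ε)) := by gcongr
    _ = _ := by
      have : (4 : ℝ) ^ (2 * r) = 16 ^ r := by rw [pow_mul]; norm_num
      rw [mul_pow, this]; ring
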